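/- **Setting.** An inhomogeneous AKLT chain with bulk sites $1,\dots,N$ and end sites $0,N+1$ is given by integers (bond numbers) $M_{j,j+1}\ge 1$, $0\le j\le N$. The spin $S_j$ at site $j$ is determined by $2S_j=M_{j-1,j}+M_{j,j+1}$ for $1\le j\le N$, $2S_0=M_{01}$, $2S_{N+1}=M_{N,N+1}$. In the Schwinger boson representation (spin $S_j$ at site $j$ is the subspace with $2S_j$ bosons $a_j,b_j$) the VBS state is $$|\mathrm{VBS}\rangle=\prod_{j=0}^{N}\bigl(a_j^\dagger b_{j+1}^\dagger-b_j^\dagger a_{j+1}^\dagger\bigr)^{M_{j,j+1}}|\mathrm{vac}\rangle .$$ For a block of $L\ge1$ contiguous bulk sites $k,\dots,r$, $r=k+L-1$ ($1\le k$, $r\le N$), the density matrix $\rho_L$ is the partial trace of $|\mathrm{VBS}\rangle\langle\mathrm{VBS}|/\langle\mathrm{VBS}|\mathrm{VBS}\rangle$ over all sites outside the block. Put $M_-=M_{k-1,k}$, $M_+=M_{r,r+1}$, $J_\pm=\tfrac12(M_-\pm M_+)$. For $J\in\{|J_-|,|J_-|+1,\dots,J_+\}$ and a point $\hat\Omega$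 of the unit sphere with polar angles $(\theta,\phi)$, and with $u=\cos\frac\theta2\,e^{i\phi/2}$, $v=\sin\frac\theta2\,e^{-i\phi/2}$, let $$|G;J,\hat\Omega\rangle=(ua_k^\dagger+vb_k^\dagger)^{J_-+J}(a_k^\dagger b_r^\dagger-b_k^\dagger a_r^\dagger)^{J_+-J}(ua_r^\dagger+vb_r^\dagger)^{-J_-+J}\prod_{j=k}^{r-1}\bigl(a_j^\dagger b_{j+1}^\dagger-b_j^\dagger a_{j+1}^\dagger\bigr)^{M_{j,j+1}}|\mathrm{vac}\rangle ,$$ let $\mathcal G_L$ be the span of all these vectors in the Hilbert space of the block, and let $P_L$ be the orthogonal projection onto $\mathcal G_L$. Let $S_{vN}(\rho)=-\mathrm{Tr}(\rho\ln\rho)$ and, for real $\alpha\ne1$, $S_R^{(\alpha)}(\rho)=\frac1{1-\alpha}\ln\mathrm{Tr}(\rho^\alpha)$, where $\rho^\alpha$ is taken on the support of $\rho$. **Theorem (large block limit).** Consider any sequence of such chains and blocks (all data may vary along the sequence) such that $L\to\infty$, the boundary bond numbers converge, $M_-\to S_-$ and $M_+\to S_+$ with $S_\pm\in\mathbb N$,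 and the bond numbers inside the block satisfy $\sum_{j=k}^{r-1}1/M_{j,j+1}\to\infty$ (which holds, for instance, if the bond numbers are uniformly bounded). Let $c=\frac{1}{(S_-+1)(S_++1)}$. Then, along the sequence: 1. eventually $\dim\mathcal G_L=(S_-+1)(S_++1)$; 2. for every $\varepsilon>0$, eventually, for all $J$ and $\hat\Omega$, one has $|G;J,\hat\Omega\rangle\neq0$ and $\bigl\|\rho_L|G;J,\hat\Omega\rangle-c\,|G;J,\hat\Omega\rangle\bigr\|\le\varepsilon\,\bigl\||G;J,\hat\Omega\rangle\bigr\|$; 3. $\|\rho_L-c\,P_L\|\to0$ in operator norm, and eventually $\rho_L$ vanishes on the orthogonal complement of $\mathcal G_L$; that is, in the limit $\rho_\infty=\frac{1}{(S_-+1)(S_++1)}I_{(S_-+1)(S_++1)}\oplus0$; 4. $S_{vN}(\rho_L)\to\ln[(S_-+1)(S_++1)]$, and $S_R^{(\alpha)}(\rho_L)\to\ln[(S_-+1)(S_++1)]$ for every real $\alpha\ne1$; so in the limit both entropies coincide, independently of $\alpha$, at the saturated value. -/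

import Mathlib

namespace AKLT

noncomputable section

/-- Creation operators in the Bargmann (polynomial) model of the bosonic Fock space: a polynomial
in the commuting variables `a†_j = X (j, 0)` and `b†_j = X (j, 1)` stands for that polynomial in the
creation operators applied to the vacuum `|vac⟩ = 1`. -/
abbrev Fock : Type := MvPolynomial (ℕ × Fin 2) ℂ

/-- The creation operator `a†_j`. -/
def aDag (j : ℕ) : Fock := MvPolynomial.X (j, 0)

/-- The creation operator `b†_j`. -/
def bDag (j : ℕ) : Fock := MvPolynomial.X (j, 1)

/-- The valence bond operator `a†_i b†_j - b†_i a†_j` between the sites `i` and `j`. -/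
def bond (i j : ℕ) : Fock := aDag i * bDag j - bDag i * aDag j

/-- Labels of the standard orthonormal basis of the spins at the sites in `s`, where the spin at
site `j` has spin value `d j / 2`. The label `x j = S + m ∈ {0, …, 2S}` is the number of `a`-bosons
at site `j`; the number of `b`-bosons is `S - m = d j - x j`. -/
abbrev Config (d : ℕ → ℕ) (s : Finset ℕ) : Type := ∀ j : s, Fin (d j + 1)

/-- The Hilbert space of the spins at the sites in `s`: the tensor product over `j ∈ s` of the
`(d j + 1)`-dimensional spin spaces, in the product basis. -/
abbrev SpinSpace (d : ℕ → ℕ) (s : Finset ℕ) : Type := EuclideanSpace ℂ (Config d s)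

/-- Boson occupation numbers of a basis label. -/
def occupation {d : ℕ → ℕ} {s : Finset ℕ} (x : Config d s) : (ℕ × Fin 2) →₀ ℕ :=
  ∑ j : s, (Finsupp.single ((j : ℕ), (0 : Fin 2)) (x j : ℕ) +
    Finsupp.single ((j : ℕ), (1 : Fin 2)) (d j - (x j : ℕ)))

/-- The vector in the spin space of the sites `s` represented by a polynomial in the creation
operators. The normalized basis state with label `x` is
`∏ j, (a†_j)^(x j) (b†_j)^(d j - x j) / √((x j)! (d j - x j)!) |vac⟩`, so its amplitude is the
coefficient of that monomial times `√(∏ j, (x j)! (d j - x j)!)`. -/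
def toSpin (d : ℕ → ℕ) (s : Finset ℕ) (p : Fock) : SpinSpace d s :=
  WithLp.toLp 2 fun x : Config d s =>
    MvPolynomial.coeff (occupation x) p *
      ((Real.sqrt (∏ j : s, (((x j : ℕ).factorial * (d j - (x j : ℕ)).factorial : ℕ) : ℝ)) : ℝ) : ℂ)

/-- The label of the sites `t` that is `x` on `s` and `z` on `t \ s`. -/
def glue {d : ℕ → ℕ} {s t : Finset ℕ} (x : Config d s) (z : Config d (t \ s)) : Config d t :=
  fun j => if h : (j : ℕ) ∈ s then x ⟨j, h⟩ else z ⟨j, Finset.mem_sdiff.mpr ⟨j.2, h⟩⟩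

/-- Partial trace over the sites in `t \ s`, for `s ⊆ t`. -/
def partialTrace {d : ℕ → ℕ} (s t : Finset ℕ) (ρ : Matrix (Config d t) (Config d t) ℂ) :
    Matrix (Config d s) (Config d s) ℂ :=
  fun x y => ∑ z : Config d (t \ s), ρ (glue x z) (glue y z)

/-- The density matrix `|ψ⟩⟨ψ| / ⟨ψ|ψ⟩`. -/
def pureState {n : Type} [Fintype n] (ψ : EuclideanSpace ℂ n) : Matrix n n ℂ :=
  fun x y => ψ x * star (ψ y) / (inner ℂ ψ ψ : ℂ)

/-- The von Neumann entropy `-Tr(ρ ln ρ)`. -/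
def vonNeumannEntropy {n : Type} [Fintype n] [DecidableEq n] (ρ : Matrix n n ℂ) : ℝ :=
  -(Matrix.trace (cfc (fun x : ℝ => x * Real.log x) ρ)).re

/-- The Rényi entropy `ln(Tr ρ^α) / (1 - α)`; the power `ρ^α` is taken on the support of `ρ`, so
that the trace is the sum of `λ^α` over the nonzero eigenvalues `λ`, with multiplicity. -/
def renyiEntropy {n : Type} [Fintype n] [DecidableEq n] (α : ℝ) (ρ : Matrix n n ℂ) : ℝ :=
  1 / (1 - α) * Real.log (Matrix.trace (cfc (fun x : ℝ => if x = 0 then 0 else x ^ α) ρ)).re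

/-- The spinor coordinate `u` of the point of the unit sphere with polar angles `θ`, `φ`. -/
def spinorU (θ φ : ℝ) : ℂ := (Real.cos (θ / 2) : ℂ) * Complex.exp (Complex.I * ((φ / 2 : ℝ) : ℂ))

/-- The spinor coordinate `v` of the point of the unit sphere with polar angles `θ`, `φ`. -/
def spinorV (θ φ : ℝ) : ℂ := (Real.sin (θ / 2) : ℂ) * Complex.exp (-Complex.I * ((φ / 2 : ℝ) : ℂ))

/-- An inhomogeneous AKLT chain with bulk sites `1, …, N`, end sites `0` and `N + 1` and bond
numbers `M j = M_{j,j+1} ≥ 1` for `0 ≤ j ≤ N`, together with a block of `L` contiguous bulk sites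
`k, …, k + L - 1`. -/
structure ChainBlock where
  N : ℕ
  M : ℕ → ℕ
  one_le_M : ∀ j ≤ N, 1 ≤ M j
  k : ℕ
  L : ℕ
  one_le_k : 1 ≤ k
  one_le_L : 1 ≤ L
  block_le : k + L ≤ N + 1

namespace ChainBlock

variable (C : ChainBlock)

/-- Twice the spin at site `j`: `2 S_j = M_{j-1,j} + M_{j,j+1}` in the bulk, `2 S_0 = M_{0,1}` and
`2 S_{N+1} = M_{N,N+1}` at the ends. -/
def twoS (j : ℕ) : ℕ := (if j = 0 then 0 else C.M (j - 1)) + (if j = C.N + 1 then 0 else C.M j)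

/-- The sites `0, …, N + 1` of the chain. -/
def sites : Finset ℕ := Finset.Icc 0 (C.N + 1)

/-- The first site of the block. -/
def first : ℕ := C.k

/-- The last site of the block. -/
def last : ℕ := C.k + C.L - 1

/-- The sites of the block. -/
def block : Finset ℕ := Finset.Icc C.first C.last

/-- The number of the bond that joins the first site of the block to its left neighbour
(`M_{01}` if the block sites are numbered `1, …, L`). -/
def leftBond : ℕ := C.M (C.first - 1)

/-- The number of the bond that joins the last site of the block to its right neighbour
(`M_{L,L+1}` if the block sites are numbered `1, …, L`). -/
def rightBond : ℕ := C.M C.last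

/-- The valence-bond-solid state `|VBS⟩` of the chain. -/
def vbs : SpinSpace C.twoS C.sites :=
  toSpin C.twoS C.sites (∏ j ∈ Finset.range (C.N + 1), bond j (j + 1) ^ C.M j)

/-- The density matrix of the block: the pure state of the chain, traced over all other sites. -/
def densityMatrix : Matrix (Config C.twoS C.block) (Config C.twoS C.block) ℂ :=
  partialTrace C.block C.sites (pureState C.vbs)

/-- The density matrix of the block as an operator on the Hilbert space of the block. -/
def densityOp : SpinSpace C.twoS C.block →L[ℂ] SpinSpace C.twoS C.block :=
  Matrix.toEuclideanCLM (𝕜 := ℂ) C.densityMatrix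

/-- The block VBS state, as a polynomial in the creation operators (bonds inside the block). -/
def blockVBS : Fock := ∏ j ∈ Finset.Ico C.first C.last, bond j (j + 1) ^ C.M j

/-- The operator `A†_J` for `J = J₊ - n`, where `J₊ = (leftBond + rightBond) / 2` and
`J₋ = (leftBond - rightBond) / 2`. Then `J₋ + J = leftBond - n`, `J₊ - J = n` and
`-J₋ + J = rightBond - n`; the range `|J₋| ≤ J ≤ J₊` is `n ≤ min leftBond rightBond`. -/
def operatorA (n : ℕ) (θ φ : ℝ) : Fock :=
  (MvPolynomial.C (spinorU θ φ) * aDag C.first +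
      MvPolynomial.C (spinorV θ φ) * bDag C.first) ^ (C.leftBond - n) *
    bond C.first C.last ^ n *
    (MvPolynomial.C (spinorU θ φ) * aDag C.last +
      MvPolynomial.C (spinorV θ φ) * bDag C.last) ^ (C.rightBond - n)

/-- The state `|G; J, Ω⟩ = A†_J |VBS_L⟩` of the block, for `J = J₊ - n` and the point `Ω` of the unit
sphere with polar angles `θ`, `φ`. -/
def groundState (n : ℕ) (θ φ : ℝ) : SpinSpace C.twoS C.block :=
  toSpin C.twoS C.block (C.operatorA n θ φ * C.blockVBS)

/-- The span of the states `|G; J, Ω⟩`, over all `|J₋| ≤ J ≤ J₊` and all points `Ω` of the sphere. -/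
def groundSpace : Submodule ℂ (SpinSpace C.twoS C.block) :=
  Submodule.span ℂ {ψ | ∃ n ≤ min C.leftBond C.rightBond, ∃ θ ∈ Set.Icc (0 : ℝ) Real.pi,
    ∃ φ ∈ Set.Icc (0 : ℝ) (2 * Real.pi), ψ = C.groundState n θ φ}

end ChainBlock

end

end AKLT

namespace AKLT

open MvPolynomial

noncomputable section

/-! Cut the two bonds that join the block to its environment and expand them binomially. The VBS
state becomes a sum of `(leftBond + 1) * (rightBond + 1)` products of a block vector and an
environment vector (`vbs_glue`). The environment vectors are exactly orthogonal with a common norm,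
since each outer piece of the chain can be contracted from its free end (`exists_inner_envVec`).
Hence the density matrix is the normalized sum of `|w⟩⟨w|` over the block vectors
(`densityMatrix_eq`), and these vectors span the ground space of every block (`groundSpace_eq`).
What remains is their Gram matrix. If it is close to a multiple of the identity, the density matrix
is close to a scalar on the span and zero on its complement; trace one then forces exactly as many
nonzero eigenvalues as there are block vectors, all close to `c`, and the entropies follow by
continuity at `c`.

The Gram matrix is computed with a bilinear form for which multiplication by a variable is adjoint
to differentiation. Contracting the bonds that leave a site acts on the sector of angular momentum
`l` as a scalar (`bargmann_transfer`). After a telescoping shift, each ratio of the scalar for `l ≥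
1` to the one for `l = 0` is at most `M / (M + 2)` (`prod_transferEigenvalue_le`), so only the
sector `l = 0` survives when the sum of the `1 / M` diverges (`decay_le`).

The sectors are separated without Clebsch-Gordan coefficients. In the array of overlaps `gram`, with
`s` extra bosons at the first site, the difference of two neighbours on an antidiagonal is an
overlap with one boson fewer (`gram_succ_sub`), while the binomially weighted antidiagonal sums see
only the top sector `l = s` (`gram_antidiagonal`). These data control the whole array
(`norm_le_of_antidiagonal`), so induction on `s` gives the limit with an error bound
(`exists_gram_bound`). -/

/-! ### The Bargmann form and homogeneity at a site -/

/-- The bilinear Bargmann form: monomials are orthogonal, and `X^m` has square `m!`. -/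
def bargmann : Fock →ₗ[ℂ] Fock →ₗ[ℂ] ℂ :=
  (basisMonomials (ℕ × Fin 2) ℂ).constr ℂ fun m =>
    ((m.prod fun _ e => (e.factorial : ℂ))) • lcoeff ℂ m

lemma bargmann_monomial (m : (ℕ × Fin 2) →₀ ℕ) (q : Fock) :
    bargmann (monomial m 1) q = (m.prod fun _ e => (e.factorial : ℂ)) * coeff m q := by
  have h := (basisMonomials (ℕ × Fin 2) ℂ).constr_basis ℂ (fun m =>
    ((m.prod fun _ e => (e.factorial : ℂ))) • lcoeff ℂ m) m
  rw [coe_basisMonomials] at h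
  simp only [bargmann]
  rw [h]
  simp

lemma prod_factorial_add_single (m : (ℕ × Fin 2) →₀ ℕ) (i : ℕ × Fin 2) :
    ((m + Finsupp.single i 1).prod fun _ e => (e.factorial : ℂ)) =
      (m i + 1) * m.prod fun _ e => (e.factorial : ℂ) := by
  classical
  have key : ∀ f : (ℕ × Fin 2) →₀ ℕ, (f.prod fun _ e => (e.factorial : ℂ)) =
      (f i).factorial * (f.erase i).prod fun _ e => (e.factorial : ℂ) := by
    intro f
    exact (Finsupp.mul_prod_erase' f i (fun _ e => (e.factorial : ℂ)) (by simp)).symm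
  rw [key, key m, Finsupp.erase_add, Finsupp.erase_single, add_zero]
  simp [Nat.factorial_succ]
  ring

lemma fock_induction {P : Fock → Prop} (hm : ∀ m, P (monomial m 1))
    (ha : ∀ p q, P p → P q → P (p + q)) (hs : ∀ (c : ℂ) p, P p → P (c • p)) (p : Fock) : P p := by
  induction p using MvPolynomial.induction_on' with
  | monomial m c =>
    have := hs c _ (hm m)
    rwa [smul_monomial, smul_eq_mul, mul_one] at this
  | add p q hp hq => exact ha p q hp hq

/-- On monomials, raising the exponent of `X i` multiplies `m!` by `m i + 1`, which is the factor
produced by the derivative. Every contraction below rests on this adjunction. -/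
lemma bargmann_X_mul (i : ℕ × Fin 2) (p q : Fock) :
    bargmann (X i * p) q = bargmann p (pderiv i q) := by
  induction p using fock_induction with
  | hm m =>
    rw [X, monomial_mul, mul_one, bargmann_monomial, bargmann_monomial, coeff_pderiv, add_comm,
      prod_factorial_add_single]
    ring
  | ha p q hp hq => simp [mul_add, hp, hq]
  | hs c p hp => simp [hp]

lemma bargmann_comm (p q : Fock) : bargmann p q = bargmann q p := by
  classical
  induction p using fock_induction with
  | hm m =>
    induction q using fock_induction with
    | hm n =>
      rw [bargmann_monomial, bargmann_monomial, coeff_monomial, coeff_monomial]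
      by_cases h : n = m
      · subst h; simp
      · simp [h, Ne.symm h]
    | ha p q hp hq => simp [hp, hq]
    | hs c p hp => simp [hp]
  | ha p q hp hq => simp [hp, hq]
  | hs c p hp => simp [hp]

/-- The polynomial `p` is homogeneous of degree `d` in the creation operators of the site `j`
(Euler's identity). -/
def SiteHom (j d : ℕ) (p : Fock) : Prop :=
  aDag j * pderiv (j, 0) p + bDag j * pderiv (j, 1) p = (d : Fock) * p

lemma SiteHom.congr {j d d' : ℕ} {p : Fock} (h : SiteHom j d p) (hd : d = d') : SiteHom j d' p :=
  hd ▸ h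

lemma SiteHom.mul {j d e : ℕ} {p q : Fock} (hp : SiteHom j d p) (hq : SiteHom j e q) :
    SiteHom j (d + e) (p * q) := by
  unfold SiteHom at *
  rw [pderiv_mul, pderiv_mul]
  push_cast
  linear_combination q * hp + p * hq

lemma SiteHom.one (j : ℕ) : SiteHom j 0 1 := by simp [SiteHom]

lemma SiteHom.pow {j d : ℕ} {p : Fock} (hp : SiteHom j d p) (n : ℕ) :
    SiteHom j (n * d) (p ^ n) := by
  induction n with
  | zero => simpa using SiteHom.one j
  | succ n ih => rw [pow_succ]; exact (ih.mul hp).congr (by ring)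

lemma SiteHom.add {j d : ℕ} {p q : Fock} (hp : SiteHom j d p) (hq : SiteHom j d q) :
    SiteHom j d (p + q) := by
  unfold SiteHom at *
  rw [map_add, map_add]
  linear_combination hp + hq

lemma SiteHom.C_mul {j d : ℕ} {p : Fock} (c : ℂ) (hp : SiteHom j d p) :
    SiteHom j d (C c * p) := by
  unfold SiteHom at *
  rw [pderiv_C_mul, pderiv_C_mul]
  linear_combination C c * hp

lemma SiteHom.neg {j d : ℕ} {p : Fock} (hp : SiteHom j d p) : SiteHom j d (-p) := by
  simpa using hp.C_mul (-1)

lemma siteHom_X (i : ℕ) (x : Fin 2) (j : ℕ) :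
    SiteHom j (if j = i then 1 else 0) (X (i, x) : Fock) := by
  unfold SiteHom aDag bDag
  by_cases h : j = i
  · subst h
    fin_cases x <;> simp [pderiv_X]
  · simp [pderiv_X, Ne.symm h, h]

lemma siteHom_aDag (i j : ℕ) : SiteHom j (if j = i then 1 else 0) (aDag i) := siteHom_X i 0 j

lemma siteHom_bDag (i j : ℕ) : SiteHom j (if j = i then 1 else 0) (bDag i) := siteHom_X i 1 j

lemma siteHom_bond (i k j : ℕ) :
    SiteHom j ((if j = i then 1 else 0) + (if j = k then 1 else 0)) (bond i k) := by
  unfold bond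
  rw [sub_eq_add_neg]
  exact ((siteHom_aDag i j).mul (siteHom_bDag k j)).add
    ((siteHom_bDag i j).mul (siteHom_aDag k j)).neg

/-- `X i * pderiv i` multiplies each coefficient by the exponent of `X i`, so Euler's identity can
be read off monomial by monomial. -/
lemma SiteHom.coeff {j d : ℕ} {p : Fock} (hp : SiteHom j d p) {m : (ℕ × Fin 2) →₀ ℕ}
    (hm : coeff m p ≠ 0) : m (j, 0) + m (j, 1) = d := by
  classical
  have key : ∀ (i : ℕ × Fin 2) (p : Fock),
      MvPolynomial.coeff m (X i * pderiv i p) = m i * MvPolynomial.coeff m p := by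
    intro i p
    induction p using MvPolynomial.induction_on' with
    | monomial n c =>
      rw [X_mul_pderiv_monomial, coeff_smul, coeff_monomial]
      by_cases h : n = m <;> simp [h]
    | add p q hp hq => simp only [map_add, mul_add, coeff_add, hp, hq]
  have h := congrArg (MvPolynomial.coeff m) hp
  unfold aDag bDag at h
  rw [coeff_add, key, key, show (d : Fock) = C (d : ℂ) by simp, coeff_C_mul, ← add_mul] at h
  exact_mod_cast mul_right_cancel₀ hm h

lemma SiteHom.pderiv_eq_zero {j : ℕ} {p : Fock} (hp : SiteHom j 0 p) (x : Fin 2) :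
    pderiv (j, x) p = 0 := by
  ext m
  rw [coeff_pderiv, coeff_zero]
  by_cases h : MvPolynomial.coeff (m + Finsupp.single (j, x) 1) p = 0
  · rw [h, zero_mul]
  · have := hp.coeff h
    fin_cases x <;> simp at this

/-! ### Contraction of bonds and the transfer eigenvalues -/

/-- The linear form `x a†_j + y b†_j`. -/
def spinor (x y : ℂ) (j : ℕ) : Fock := C x * aDag j + C y * bDag j

lemma siteHom_spinor (x y : ℂ) (i j : ℕ) :
    SiteHom j (if j = i then 1 else 0) (spinor x y i) :=
  ((siteHom_aDag i j).C_mul x).add ((siteHom_bDag i j).C_mul y)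

lemma bargmann_spinor_mul (x y : ℂ) (j : ℕ) (p q : Fock) :
    bargmann (spinor x y j * p) q =
      bargmann p (C x * pderiv (j, 0) q + C y * pderiv (j, 1) q) := by
  rw [spinor, add_mul, map_add, LinearMap.add_apply, mul_assoc, mul_assoc, C_mul', C_mul', C_mul',
    C_mul']
  simp [aDag, bDag, bargmann_X_mul]

/-- Contracting `n` valence bonds with a site that carries nothing else. -/
lemma bargmann_bond_pow {i j : ℕ} (hij : i ≠ j) {d : ℕ} {K K' : Fock} (hK' : SiteHom i 0 K')
    (hd : SiteHom j d K') (n : ℕ) :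
    bargmann (bond i j ^ n * K) (bond i j ^ n * K') =
      (n.factorial * (d + 2).ascFactorial n : ℕ) * bargmann K K' := by
  induction n with
  | zero => simp
  | succ n ih =>
    have e1 : bond i j ^ (n + 1) * K =
        X (i, 0) * (X (j, 1) * (bond i j ^ n * K)) - X (i, 1) * (X (j, 0) * (bond i j ^ n * K)) := by
      rw [pow_succ']; unfold bond aDag bDag; ring
    have h0 := hK'.pderiv_eq_zero 0
    have h1 := hK'.pderiv_eq_zero 1
    have hji := hij.symm
    have e2 : pderiv (i, 0) (bond i j ^ (n + 1) * K') =
        (n + 1 : Fock) * (bDag j * (bond i j ^ n * K')) := by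
      rw [pderiv_mul, h0, pderiv_pow]
      simp [bond, aDag, bDag, pderiv_X, hji]
      ring
    have e3 : pderiv (i, 1) (bond i j ^ (n + 1) * K') =
        -((n + 1 : Fock) * (aDag j * (bond i j ^ n * K'))) := by
      rw [pderiv_mul, h1, pderiv_pow]
      simp [bond, aDag, bDag, pderiv_X, hji]
      ring
    have hh : SiteHom j (n + d) (bond i j ^ n * K') :=
      (((siteHom_bond i j j).pow n).mul hd).congr (by simp [hji])
    -- This is the adjoint of multiplication by one bond. In the factor `d + 2 + n`, the 2 comes
    -- from differentiating the explicit `bDag j` and `aDag j`, and `n + d` from Euler's identity at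
    -- `j`.
    have e4 : pderiv (j, 1) (pderiv (i, 0) (bond i j ^ (n + 1) * K')) -
        pderiv (j, 0) (pderiv (i, 1) (bond i j ^ (n + 1) * K')) =
        (((n + 1) * (d + 2 + n) : ℕ) : ℂ) • (bond i j ^ n * K') := by
      rw [e2, e3, map_neg, sub_neg_eq_add, ← C_mul']
      unfold SiteHom at hh
      generalize bond i j ^ n * K' = Q at hh ⊢
      have c0 : ∀ x, pderiv x (n + 1 : Fock) = 0 := by
        intro x
        simp
      rw [pderiv_mul, pderiv_mul, pderiv_mul, pderiv_mul, c0, c0]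
      unfold aDag bDag at *
      rw [pderiv_X_self, pderiv_X_self]
      simp only [map_natCast]
      push_cast at hh ⊢
      linear_combination (n + 1 : Fock) * hh
    rw [e1, map_sub, LinearMap.sub_apply, bargmann_X_mul, bargmann_X_mul, bargmann_X_mul,
      bargmann_X_mul, ← map_sub, e4, map_smul, smul_eq_mul, ih, Nat.ascFactorial_succ,
      Nat.factorial_succ]
    push_cast
    ring

/-- The adjoint of a spinor is a directional derivative, and `h` says that it kills the spinor `x'
y'`. It can therefore only hit a bond, which it turns into a spinor at `k`; the falling factorial
counts the choices, and vanishes when `M - t` truncates. -/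
lemma bargmann_spinor_pow {j k : ℕ} (hjk : j ≠ k) {x y x' y' : ℂ} (h : x * x' + y * y' = 0)
    (l t : ℕ) (P : Fock) : ∀ (M : ℕ) (K : Fock), SiteHom j 0 K →
    bargmann (spinor x y j ^ t * P) (spinor x' y' j ^ l * (bond j k ^ M * K)) =
      M.descFactorial t *
        bargmann P (spinor x' y' j ^ l * (bond j k ^ (M - t) * (spinor (-y) x k ^ t * K))) := by
  induction t with
  | zero => intro M K _; simp
  | succ t ih =>
    intro M K hK
    have hkj := hjk.symm
    have h0 := hK.pderiv_eq_zero 0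
    have h1 := hK.pderiv_eq_zero 1
    have hC : (C x * C x' + C y * C y' : Fock) = 0 := by rw [← C_mul, ← C_mul, ← C_add, h, C_0]
    rw [pow_succ', mul_assoc, bargmann_spinor_mul]
    have ds : ∀ c : Fin 2, pderiv (j, c) (spinor x' y' j) = C (if c = 0 then x' else y') := by
      intro c
      fin_cases c <;> simp [spinor, aDag, bDag, pderiv_X]
    have db : ∀ c : Fin 2, pderiv (j, c) (bond j k) = if c = 0 then bDag k else -aDag k := by
      intro c
      fin_cases c <;>
      simp [bond, aDag, bDag, pderiv_X, hkj]
    have e : C x * pderiv (j, 0) (spinor x' y' j ^ l * (bond j k ^ M * K)) +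
        C y * pderiv (j, 1) (spinor x' y' j ^ l * (bond j k ^ M * K)) =
        (M : ℂ) • (spinor x' y' j ^ l * (bond j k ^ (M - 1) * (spinor (-y) x k * K))) := by
      rw [← C_mul']
      simp only [pderiv_mul, pderiv_pow, h0, h1, ds, db, map_natCast]
      simp only [if_true, one_ne_zero, if_false]
      have : spinor (-y) x k = C x * bDag k - C y * aDag k := by
        simp [spinor]; ring
      rw [this]
      linear_combination
        ((l : Fock) * spinor x' y' j ^ (l - 1) * bond j k ^ M * K) * hC
    rw [e, map_smul, ih (M - 1) _ (((siteHom_spinor _ _ k j).mul hK).congr (by simp [hjk])),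
      smul_eq_mul]
    rcases M with _ | M
    · simp
    · rw [Nat.succ_descFactorial_succ]
      have : spinor (-y) x k ^ t * (spinor (-y) x k * K) = spinor (-y) x k ^ (t + 1) * K := by ring
      rw [this, Nat.add_sub_add_right, Nat.sub_zero]
      push_cast
      ring

/-- The eigenvalue of the transfer operator in the sector of angular momentum `l`, up to sign. -/
def transferEigenvalue (l M M' : ℕ) : ℕ :=
  M.descFactorial l ^ 2 * ((M - l).factorial * (M' + l + 2).ascFactorial (M - l))

/-- The spinors on the two sides are orthogonal, so they cannot contract with each other: on each
side all `l` of them consume bonds and reappear at `k`, which gives the square of the falling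
factorial. The other `M - l` bonds contract among themselves. -/
lemma bargmann_transfer {j k : ℕ} (hjk : j ≠ k) (α β : ℂ) (l M M' : ℕ) {K K' : Fock}
    (hK : SiteHom j 0 K) (hK' : SiteHom j 0 K') (hd : SiteHom k M' K') :
    bargmann (spinor (-β) α j ^ l * (bond j k ^ M * K)) (spinor α β j ^ l * (bond j k ^ M * K')) =
      (-1) ^ l * transferEigenvalue l M M' *
        bargmann (spinor (-β) α k ^ l * K) (spinor α β k ^ l * K') := by
  have hs : spinor (-α) (-β) k = -spinor α β k := by simp [spinor]; ring
  have hsK : SiteHom j 0 (spinor α β k ^ l * K') :=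
    (((siteHom_spinor _ _ k j).pow l).mul hK').congr (by simp [hjk])
  have hsK2 : SiteHom k (M' + l) (spinor α β k ^ l * K') :=
    (((siteHom_spinor _ _ k k).pow l).mul hd).congr (by simp [add_comm])
  rw [bargmann_spinor_pow hjk (by ring) l l _ M K' hK', hs, bargmann_comm,
    ← one_mul (bond j k ^ M * K), ← pow_zero (spinor (-β) α j),
    bargmann_spinor_pow hjk (by ring) 0 l _ M K hK, bargmann_comm, pow_zero, one_mul, neg_pow]
  have e : bond j k ^ (M - l) * ((-1) ^ l * spinor α β k ^ l * K') =
      (-1 : ℂ) ^ l • (bond j k ^ (M - l) * (spinor α β k ^ l * K')) := by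
    rw [← C_mul']; simp only [map_pow, map_neg, map_one]; ring
  rw [e, map_smul, bargmann_bond_pow hjk hsK hsK2, transferEigenvalue, smul_eq_mul]
  push_cast
  ring

/-- The valence bonds between the sites `k, …, r`. -/
def chain (M : ℕ → ℕ) (k r : ℕ) : Fock := ∏ j ∈ Finset.Ico k r, bond j (j + 1) ^ M j

lemma chain_self (M : ℕ → ℕ) (k : ℕ) : chain M k k = 1 := by simp [chain]

lemma chain_succ_top (M : ℕ → ℕ) {k r : ℕ} (h : k ≤ r) :
    chain M k (r + 1) = chain M k r * bond r (r + 1) ^ M r := Finset.prod_Ico_succ_top h _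

lemma chain_eq_mul (M : ℕ → ℕ) {k r : ℕ} (h : k < r) :
    chain M k r = bond k (k + 1) ^ M k * chain M (k + 1) r := Finset.prod_eq_prod_Ico_succ_bot h _

lemma siteHom_chain (M : ℕ → ℕ) {k r : ℕ} (h : k ≤ r) (j : ℕ) :
    SiteHom j ((if k < j ∧ j ≤ r then M (j - 1) else 0) + (if k ≤ j ∧ j < r then M j else 0))
      (chain M k r) := by
  induction r, h using Nat.le_induction with
  | base =>
    rw [chain_self]
    exact (SiteHom.one j).congr (by split_ifs <;> omega)
  | succ r hr ih =>
    rw [chain_succ_top M hr]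
    refine (ih.mul ((siteHom_bond r (r + 1) j).pow (M r))).congr ?_
    by_cases h1 : j = r
    · subst h1
      simp [hr]
    · by_cases h2 : j = r + 1
      · subst h2
        simp [show k < r + 1 by omega]
      · have a1 : (k < j ∧ j ≤ r + 1) ↔ (k < j ∧ j ≤ r) := by omega
        have a2 : (k ≤ j ∧ j < r + 1) ↔ (k ≤ j ∧ j < r) := by omega
        simp only [h1, h2, a1, a2]
        simp

/-- The spinors that reappear at `k + 1` have the same form as those at `k`, so `bargmann_transfer`
iterates. -/
lemma bargmann_chain (M : ℕ → ℕ) (α β : ℂ) (l : ℕ) {r : ℕ} {g g' : Fock}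
    (hr : SiteHom r (M r) g') : ∀ {k : ℕ}, k ≤ r →
    (∀ j, k ≤ j → j < r → SiteHom j 0 g) → (∀ j, k ≤ j → j < r → SiteHom j 0 g') →
    bargmann (spinor (-β) α k ^ l * (chain M k r * g)) (spinor α β k ^ l * (chain M k r * g')) =
      (∏ j ∈ Finset.Ico k r, ((-1) ^ l * (transferEigenvalue l (M j) (M (j + 1)) : ℂ))) *
        bargmann (spinor (-β) α r ^ l * g) (spinor α β r ^ l * g') := by
  intro k hk
  induction hk using Nat.decreasingInduction with
  | self => simp [chain_self]
  | of_succ k hkr ih =>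
    intro hg hg'
    have hc : SiteHom k 0 (chain M (k + 1) r) :=
      (siteHom_chain M hkr k).congr (by simp)
    have hd : SiteHom (k + 1) (M (k + 1)) (chain M (k + 1) r * g') := by
      rcases (show k + 1 ≤ r from hkr).eq_or_lt with h | h
      · subst h
        simpa [chain_self] using hr
      · exact ((siteHom_chain M hkr (k + 1)).mul (hg' (k + 1) (by omega) h)).congr (by simp [h])
    have ht := bargmann_transfer (show k ≠ k + 1 by omega) α β l (M k) (M (k + 1))
      ((hc.mul (hg k le_rfl hkr)).congr (by simp)) ((hc.mul (hg' k le_rfl hkr)).congr (by simp)) hd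
    rw [chain_eq_mul M hkr, mul_assoc, mul_assoc, ht,
      ih (fun j h1 h2 => hg j (by omega) h2) (fun j h1 h2 => hg' j (by omega) h2),
      Finset.prod_eq_prod_Ico_succ_bot hkr, ← mul_assoc]

/-! ### Arrays controlled along antidiagonals -/

/-- An array nearly constant along each antidiagonal is close to its weighted mean there. This
replaces the decomposition of a product of two spins: differences lie in the lower sectors, weighted
sums see the top one. -/
lemma norm_le_of_antidiagonal {m m' : ℕ} {e : ℕ → ℕ → ℂ} {δ η : ℝ} (hδ : 0 ≤ δ)
    (hd : ∀ i < m, ∀ i' < m', ‖e (i + 1) i' - e i (i' + 1)‖ ≤ δ)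
    (hz : ∀ t, ‖∑ i ∈ Finset.range (m + 1), ∑ i' ∈ Finset.range (m' + 1),
      if i + i' = t then (m.choose i * m'.choose i' : ℕ) * e i i' else 0‖ ≤ η)
    {i i' : ℕ} (hi : i ≤ m) (hi' : i' ≤ m') : ‖e i i'‖ ≤ η + m * δ := by
  have step : ∀ n j j', j + n ≤ m → j' + n ≤ m' → ‖e (j + n) j' - e j (j' + n)‖ ≤ n * δ := by
    intro n
    induction n with
    | zero => simp
    | succ n ih =>
      intro j j' h1 h2
      have a := ih (j + 1) j' (by omega) (by omega)
      have b := hd j (by omega) (j' + n) (by omega)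
      have : e (j + (n + 1)) j' - e j (j' + (n + 1)) =
          (e (j + 1 + n) j' - e (j + 1) (j' + n)) + (e (j + 1) (j' + n) - e j (j' + n + 1)) := by
        rw [show j + 1 + n = j + (n + 1) by ring, show j' + n + 1 = j' + (n + 1) by ring]; ring
      rw [this]
      refine (norm_add_le _ _).trans ?_
      push_cast
      linarith
  have diff : ∀ j ≤ m, ∀ j' ≤ m', j + j' = i + i' → ‖e i i' - e j j'‖ ≤ m * δ := by
    intro j hj j' hj' h
    rcases le_total j i with hji | hji
    · obtain ⟨n, rfl⟩ := Nat.exists_eq_add_of_le hji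
      obtain rfl : j' = i' + n := by omega
      refine (step n j i' hi hj').trans ?_
      have : (n : ℝ) ≤ m := by exact_mod_cast (by omega : n ≤ m)
      gcongr
    · obtain ⟨n, rfl⟩ := Nat.exists_eq_add_of_le hji
      obtain rfl : i' = j' + n := by omega
      rw [norm_sub_rev]
      refine (step n i j' hj hi').trans ?_
      have : (n : ℝ) ≤ m := by exact_mod_cast (by omega : n ≤ m)
      gcongr
  -- `W * e i i'` is the weighted antidiagonal sum plus weighted differences; `1 ≤ W` because the
  -- entry `(i, i')` alone has weight at least 1.
  set w : ℕ → ℕ → ℝ := fun j j' =>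
    if j + j' = i + i' then (m.choose j * m'.choose j' : ℕ) else 0 with hw
  have hw0 : ∀ j j', 0 ≤ w j j' := by
    intro j j'; simp only [hw]; split_ifs <;> positivity
  set W : ℝ := ∑ j ∈ Finset.range (m + 1), ∑ j' ∈ Finset.range (m' + 1), w j j' with hW
  have hW1 : 1 ≤ W := by
    have h1 : w i i' ≤ ∑ j' ∈ Finset.range (m' + 1), w i j' :=
      Finset.single_le_sum (f := fun j' => w i j') (fun j' _ => hw0 i j') (by simp; omega)
    have h2 : ∑ j' ∈ Finset.range (m' + 1), w i j' ≤ W :=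
      Finset.single_le_sum (f := fun j => ∑ j' ∈ Finset.range (m' + 1), w j j')
        (fun j _ => Finset.sum_nonneg fun j' _ => hw0 j j') (by simp; omega)
    have h3 : 1 ≤ w i i' := by
      simp only [hw, if_true]
      exact_mod_cast Nat.mul_pos (Nat.choose_pos hi) (Nat.choose_pos hi')
    linarith
  have key : (W : ℂ) * e i i' =
      (∑ j ∈ Finset.range (m + 1), ∑ j' ∈ Finset.range (m' + 1),
        if j + j' = i + i' then (m.choose j * m'.choose j' : ℕ) * e j j' else 0) +
      ∑ j ∈ Finset.range (m + 1), ∑ j' ∈ Finset.range (m' + 1),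
        (w j j' : ℂ) * (e i i' - e j j') := by
    rw [hW]
    push_cast
    simp only [Finset.sum_mul, ← Finset.sum_add_distrib]
    refine Finset.sum_congr rfl fun j _ => Finset.sum_congr rfl fun j' _ => ?_
    simp only [hw]
    split_ifs <;> push_cast <;> ring
  have bound : ‖∑ j ∈ Finset.range (m + 1), ∑ j' ∈ Finset.range (m' + 1),
        (w j j' : ℂ) * (e i i' - e j j')‖ ≤ W * (m * δ) := by
    rw [hW, Finset.sum_mul]
    refine norm_sum_le_of_le _ fun j hj => ?_
    rw [Finset.sum_mul]
    refine norm_sum_le_of_le _ fun j' hj' => ?_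
    rw [norm_mul, Complex.norm_real, Real.norm_of_nonneg (hw0 j j')]
    by_cases h : j + j' = i + i'
    · exact mul_le_mul_of_nonneg_left (diff j (by simp at hj; omega) j' (by simp at hj'; omega) h)
        (hw0 j j')
    · simp [hw, h]
  have hη : 0 ≤ η := (norm_nonneg _).trans (hz 0)
  have h1 : W * ‖e i i'‖ ≤ η + W * (m * δ) := by
    have : ‖(W : ℂ) * e i i'‖ = W * ‖e i i'‖ := by
      rw [norm_mul, Complex.norm_real, Real.norm_of_nonneg (by linarith)]
    rw [← this, key]
    exact (norm_add_le _ _).trans (add_le_add (hz _) bound)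
  have hmδ : 0 ≤ m * δ := by positivity
  nlinarith [norm_nonneg (e i i')]

/-- The antidiagonal sums are the coefficients of a polynomial in `α` with infinitely many roots. -/
lemma antidiagonal_eq_zero {s s' : Finset ℕ} {F : ℕ → ℕ → ℂ} {S : Set ℂ} (hS : S.Infinite)
    (h : ∀ α ∈ S, ∑ i ∈ s, ∑ i' ∈ s', α ^ (i + i') * F i i' = 0) (t : ℕ) :
    (∑ i ∈ s, ∑ i' ∈ s', if i + i' = t then F i i' else 0) = 0 := by
  set p : Polynomial ℂ := ∑ i ∈ s, ∑ i' ∈ s', Polynomial.monomial (i + i') (F i i') with hp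
  have hp0 : p = 0 := by
    refine Polynomial.eq_zero_of_infinite_isRoot p (hS.mono fun α hα => ?_)
    simp only [Set.mem_ofPred_eq, Polynomial.IsRoot, hp, Polynomial.eval_finsetSum,
      Polynomial.eval_monomial]
    rw [← h α hα]
    exact Finset.sum_congr rfl fun _ _ => Finset.sum_congr rfl fun _ _ => mul_comm _ _
  have := congrArg (fun q => Polynomial.coeff q t) hp0
  simpa [hp, Polynomial.finsetSum_coeff, Polynomial.coeff_monomial] using this

lemma bargmann_euler {j d : ℕ} {q : Fock} (hq : SiteHom j d q) (p : Fock) :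
    bargmann (aDag j * p) (aDag j * q) + bargmann (bDag j * p) (bDag j * q) =
      (d + 2) * bargmann p q := by
  have h : pderiv (j, 0) (aDag j * q) + pderiv (j, 1) (bDag j * q) = ((d : ℂ) + 2) • q := by
    unfold SiteHom at hq
    unfold aDag bDag at *
    rw [pderiv_mul, pderiv_mul, pderiv_X_self, pderiv_X_self, ← C_mul']
    simp only [map_add, map_natCast, map_ofNat]
    linear_combination hq
  conv_lhs => rw [aDag, bDag]
  rw [bargmann_X_mul, bargmann_X_mul, ← map_add]
  exact (congrArg (bargmann p) h).trans (by simp)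

lemma bargmann_X_pow_mul {i : ℕ × Fin 2} {P Q : Fock} (hP : pderiv i P = 0)
    (hQ : pderiv i Q = 0) (n n' : ℕ) :
    bargmann (X i ^ n * P) (X i ^ n' * Q) = if n = n' then n.factorial * bargmann P Q else 0 := by
  have hd : ∀ (n : ℕ) {Q : Fock}, pderiv i Q = 0 →
      pderiv i (X i ^ (n + 1) * Q) = ((n : ℂ) + 1) • (X i ^ n * Q) := by
    intro n Q hQ
    rw [pderiv_mul, hQ, pderiv_pow, pderiv_X_self, ← C_mul']
    simp
    ring
  induction n generalizing n' with
  | zero =>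
    rcases n' with _ | n'
    · simp
    · rw [bargmann_comm, pow_succ', mul_assoc, bargmann_X_mul]
      simp [hP]
  | succ n ih =>
    rcases n' with _ | n'
    · rw [pow_succ', mul_assoc, bargmann_X_mul]
      simp [hQ]
    · rw [pow_succ' _ n, mul_assoc, bargmann_X_mul, hd n' hQ, map_smul, ih, smul_eq_mul]
      simp only [Nat.add_right_cancel_iff]
      split_ifs with h
      · subst h
        rw [Nat.factorial_succ]
        push_cast
        ring
      · simp

lemma bargmann_site_mul (j x y x' y' : ℕ) {P Q : Fock} (hP : SiteHom j 0 P) (hQ : SiteHom j 0 Q) :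
    bargmann (aDag j ^ x * bDag j ^ y * P) (aDag j ^ x' * bDag j ^ y' * Q) =
      if x = x' ∧ y = y' then (x.factorial * y.factorial : ℕ) * bargmann P Q else 0 := by
  have h : ∀ {P : Fock} (y : ℕ), SiteHom j 0 P → pderiv (j, 0) (X (j, 1) ^ y * P) = 0 := by
    intro P y hP
    rw [pderiv_mul, hP.pderiv_eq_zero, pderiv_pow, pderiv_X_of_ne (by simp)]
    simp
  rw [aDag, bDag, mul_assoc, mul_assoc, bargmann_X_pow_mul (h y hP) (h y' hQ),
    bargmann_X_pow_mul (hP.pderiv_eq_zero 1) (hQ.pderiv_eq_zero 1)]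
  by_cases h1 : x = x' <;> by_cases h2 : y = y' <;> simp [h1, h2, mul_assoc]

lemma bargmann_site (j x y x' y' : ℕ) :
    bargmann (aDag j ^ x * bDag j ^ y) (aDag j ^ x' * bDag j ^ y') =
      if x = x' ∧ y = y' then ((x.factorial * y.factorial : ℕ) : ℂ) else 0 := by
  have h := bargmann_site_mul j x y x' y' (SiteHom.one j) (SiteHom.one j)
  have h1 : bargmann 1 1 = 1 := by
    rw [show (1 : Fock) = monomial 0 1 from rfl, bargmann_monomial]
    simp
  simpa [h1] using h

/-! ### Recursion for the overlaps of block states -/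

/-- Overlaps of the block states whose first site carries `s` additional bosons. -/
def gram (M : ℕ → ℕ) (k r : ℕ) (g g' : Fock) (s i i' : ℕ) : ℂ :=
  bargmann (bDag k ^ i * (-aDag k) ^ (s - i) * (chain M k r * g))
    (aDag k ^ i' * bDag k ^ (s - i') * (chain M k r * g'))

lemma siteHom_chain_mul (M : ℕ → ℕ) {k r : ℕ} (hk : k ≤ r) {g : Fock} (hr : SiteHom r (M r) g)
    (hg : ∀ j, k ≤ j → j < r → SiteHom j 0 g) : SiteHom k (M k) (chain M k r * g) := by
  rcases hk.eq_or_lt with h | h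
  · subst h
    simpa [chain_self] using hr
  · exact ((siteHom_chain M hk k).mul (hg k le_rfl h)).congr (by simp [h])

lemma siteHom_monomial (k x y : ℕ) : SiteHom k (x + y) (aDag k ^ x * bDag k ^ y) :=
  (((siteHom_aDag k k).pow x).mul ((siteHom_bDag k k).pow y)).congr (by simp)

lemma siteHom_monomial_of_ne {j k : ℕ} (h : j ≠ k) (x y : ℕ) :
    SiteHom j 0 (aDag k ^ x * bDag k ^ y) :=
  (((siteHom_aDag k j).pow x).mul ((siteHom_bDag k j).pow y)).congr (by simp [h])

/-- Raising `i` puts `bDag k` on both sides; raising `i'` instead puts `-aDag k` on the left and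
`aDag k` on the right. The difference is thus the sum treated by `bargmann_euler`, at a site of
degree `s + M k`. -/
lemma gram_succ_sub (M : ℕ → ℕ) {k r : ℕ} (hk : k ≤ r) {g g' : Fock} (hr : SiteHom r (M r) g')
    (hg' : ∀ j, k ≤ j → j < r → SiteHom j 0 g') {s i i' : ℕ} (hi : i ≤ s) (hi' : i' ≤ s) :
    gram M k r g g' (s + 1) (i + 1) i' - gram M k r g g' (s + 1) i (i' + 1) =
      (M k + 2 + s : ℕ) * gram M k r g g' s i i' := by
  have hq : SiteHom k (s + M k) (aDag k ^ i' * bDag k ^ (s - i') * (chain M k r * g')) :=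
    ((siteHom_monomial k i' (s - i')).mul (siteHom_chain_mul M hk hr hg')).congr (by omega)
  have h := bargmann_euler hq (bDag k ^ i * (-aDag k) ^ (s - i) * (chain M k r * g))
  have e1 : gram M k r g g' (s + 1) (i + 1) i' =
      bargmann (bDag k * (bDag k ^ i * (-aDag k) ^ (s - i) * (chain M k r * g)))
        (bDag k * (aDag k ^ i' * bDag k ^ (s - i') * (chain M k r * g'))) := by
    rw [gram, Nat.add_sub_add_right, Nat.sub_add_comm hi']
    congr 1
    · congr 1; ring
    · ring
  have e2 : gram M k r g g' (s + 1) i (i' + 1) =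
      -bargmann (aDag k * (bDag k ^ i * (-aDag k) ^ (s - i) * (chain M k r * g)))
        (aDag k * (aDag k ^ i' * bDag k ^ (s - i') * (chain M k r * g'))) := by
    rw [gram, Nat.add_sub_add_right, Nat.sub_add_comm hi, ← LinearMap.neg_apply, ← map_neg]
    congr 1
    · congr 1; ring
    · ring
  rw [e1, e2, sub_neg_eq_add, add_comm, h, gram]
  push_cast
  ring

/-- Expand `bargmann_chain` for the spinors `(-1, α)` and `(α, 1)` in powers of `α`: the coefficient
of `α ^ t` is the sum over the antidiagonal `t`. On the right side the chain has been contracted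
away. -/
lemma gram_antidiagonal (M : ℕ → ℕ) {k r : ℕ} (hk : k ≤ r) {g g' : Fock}
    (hr : SiteHom r (M r) g') (hg : ∀ j, k ≤ j → j < r → SiteHom j 0 g)
    (hg' : ∀ j, k ≤ j → j < r → SiteHom j 0 g') (s t : ℕ) :
    (∑ i ∈ Finset.range (s + 1), ∑ i' ∈ Finset.range (s + 1),
      if i + i' = t then (s.choose i * s.choose i' : ℕ) * gram M k r g g' s i i' else 0) =
    (∏ j ∈ Finset.Ico k r, ((-1) ^ s * (transferEigenvalue s (M j) (M (j + 1)) : ℂ))) *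
      ∑ i ∈ Finset.range (s + 1), ∑ i' ∈ Finset.range (s + 1),
        if i + i' = t then (s.choose i * s.choose i' : ℕ) * gram M r r g g' s i i' else 0 := by
  set Λ := ∏ j ∈ Finset.Ico k r, ((-1) ^ s * (transferEigenvalue s (M j) (M (j + 1)) : ℂ)) with hΛ
  have expand : ∀ (α : ℂ) (j : ℕ) (p q : Fock),
      bargmann (spinor (-1) α j ^ s * p) (spinor α 1 j ^ s * q) =
      ∑ i ∈ Finset.range (s + 1), ∑ i' ∈ Finset.range (s + 1), α ^ (i + i') *
        ((s.choose i * s.choose i' : ℕ) * bargmann (bDag j ^ i * (-aDag j) ^ (s - i) * p)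
          (aDag j ^ i' * bDag j ^ (s - i') * q)) := by
    intro α j p q
    have h1 : spinor (-1) α j ^ s * p = ∑ i ∈ Finset.range (s + 1),
        (α ^ i * s.choose i : ℂ) • (bDag j ^ i * (-aDag j) ^ (s - i) * p) := by
      rw [show spinor (-1) α j = C α * bDag j + -aDag j by simp [spinor]; ring, add_pow,
        Finset.sum_mul]
      refine Finset.sum_congr rfl fun i _ => ?_
      rw [← C_mul', mul_pow]
      simp only [map_mul, map_pow, map_natCast]
      ring
    have h2 : spinor α 1 j ^ s * q = ∑ i ∈ Finset.range (s + 1),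
        (α ^ i * s.choose i : ℂ) • (aDag j ^ i * bDag j ^ (s - i) * q) := by
      rw [show spinor α 1 j = C α * aDag j + bDag j by simp [spinor], add_pow,
        Finset.sum_mul]
      refine Finset.sum_congr rfl fun i _ => ?_
      rw [← C_mul', mul_pow]
      simp only [map_mul, map_pow, map_natCast]
      ring
    rw [h1, h2, LinearMap.map_sum₂]
    refine Finset.sum_congr rfl fun i _ => ?_
    rw [map_sum]
    refine Finset.sum_congr rfl fun i' _ => ?_
    simp only [map_smul, LinearMap.smul_apply, smul_eq_mul]
    push_cast
    ring
  have main : ∀ α ∈ (Set.univ : Set ℂ), ∑ i ∈ Finset.range (s + 1), ∑ i' ∈ Finset.range (s + 1),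
      α ^ (i + i') * ((s.choose i * s.choose i' : ℕ) * gram M k r g g' s i i' -
        Λ * ((s.choose i * s.choose i' : ℕ) * gram M r r g g' s i i')) = 0 := by
    intro α _
    have h := bargmann_chain M α 1 s hr hk hg hg'
    rw [expand, expand] at h
    simp only [mul_sub, Finset.sum_sub_distrib]
    rw [sub_eq_zero]
    simp only [gram, chain_self, one_mul]
    rw [h, Finset.mul_sum]
    refine Finset.sum_congr rfl fun i _ => ?_
    rw [Finset.mul_sum]
    refine Finset.sum_congr rfl fun i' _ => ?_
    ring
  have h := antidiagonal_eq_zero Set.infinite_univ main t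
  rw [← sub_eq_zero]
  refine Eq.trans ?_ h
  rw [Finset.mul_sum, ← Finset.sum_sub_distrib]
  refine Finset.sum_congr rfl fun i _ => ?_
  rw [Finset.mul_sum, ← Finset.sum_sub_distrib]
  refine Finset.sum_congr rfl fun i' _ => ?_
  split_ifs <;> simp

/-! ### Decay of the nontrivial sectors -/

/-- Written this way, the denominator of the ratio to the sector 0 depends only on `M'`, so along a
chain it can be regrouped with the numerator at the next bond. -/
lemma transferEigenvalue_mul (l M M' : ℕ) :
    transferEigenvalue l M M' * (M' + 2).ascFactorial l =
      M.descFactorial l * transferEigenvalue 0 M M' := by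
  rcases le_or_gt l M with h | h
  · have h1 : (M - l).factorial * M.descFactorial l = M.factorial :=
      Nat.factorial_mul_descFactorial h
    have h2 : (M' + 2).ascFactorial M =
        (M' + 2).ascFactorial l * (M' + l + 2).ascFactorial (M - l) := by
      conv_lhs => rw [← Nat.add_sub_of_le h]
      rw [← Nat.ascFactorial_mul_ascFactorial, show M' + 2 + l = M' + l + 2 by ring]
    simp only [transferEigenvalue, Nat.descFactorial_zero, Nat.sub_zero, add_zero, h2, ← h1]
    ring
  · simp [transferEigenvalue, Nat.descFactorial_of_lt h]

/-- The quotient of the two factorial products is a product of `l` ratios: the first is `M / (M +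
2)`, the others are at most 1. -/
lemma descFactorial_mul_le {l : ℕ} (hl : 1 ≤ l) (M : ℕ) :
    M.descFactorial l * (M + 2) ≤ (M + 2).ascFactorial l * M := by
  obtain ⟨l, rfl⟩ := Nat.exists_eq_add_of_le' hl
  induction l with
  | zero => simp [mul_comm, Nat.ascFactorial_succ]
  | succ l ih =>
    rw [Nat.descFactorial_succ, Nat.ascFactorial_succ]
    calc (M - (l + 1)) * M.descFactorial (l + 1) * (M + 2)
        = (M - (l + 1)) * (M.descFactorial (l + 1) * (M + 2)) := by ring
      _ ≤ (M + 2 + (l + 1)) * ((M + 2).ascFactorial (l + 1) * M) :=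
          Nat.mul_le_mul (by omega) (ih (by omega))
      _ = _ := by ring

/-- The bound for the decay of correlations along the chain. -/
def decay (M : ℕ → ℕ) (k r : ℕ) : ℝ := ∏ j ∈ Finset.Ico k r, ((M j : ℝ) / (M j + 2))

/-- The product of the leading eigenvalues of the transfer operators. -/
def leadingWeight (M : ℕ → ℕ) (k r : ℕ) : ℝ :=
  ∏ j ∈ Finset.Ico k r, (transferEigenvalue 0 (M j) (M (j + 1)) : ℝ)

lemma transferEigenvalue_zero_pos (M M' : ℕ) : 0 < transferEigenvalue 0 M M' := by
  simp only [transferEigenvalue, Nat.descFactorial_zero]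
  have := Nat.ascFactorial_pos (M' + 0 + 1) (M - 0)
  have h2 := Nat.ascFactorial_pos (M' + 0 + 2 - 1) (M - 0)
  positivity

lemma leadingWeight_pos (M : ℕ → ℕ) (k r : ℕ) : 0 < leadingWeight M k r :=
  Finset.prod_pos fun _ _ => by exact_mod_cast transferEigenvalue_zero_pos _ _

lemma decay_nonneg (M : ℕ → ℕ) (k r : ℕ) : 0 ≤ decay M k r :=
  Finset.prod_nonneg fun _ _ => by positivity

lemma prod_transferEigenvalue_le (M : ℕ → ℕ) {l : ℕ} (hl : 1 ≤ l) {k r : ℕ} (hk : k ≤ r) :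
    (∏ j ∈ Finset.Ico k r, (transferEigenvalue l (M j) (M (j + 1)) : ℝ)) ≤
      (M k + 2).ascFactorial l * (leadingWeight M k r * decay M k r) := by
  -- The factor at the right end makes the induction telescope; being at least 1, it is dropped at
  -- the end.
  have main : (∏ j ∈ Finset.Ico k r, (transferEigenvalue l (M j) (M (j + 1)) : ℝ)) *
      (M r + 2).ascFactorial l ≤
      (M k + 2).ascFactorial l * (leadingWeight M k r * decay M k r) := by
    induction r, hk using Nat.le_induction with
    | base => simp [leadingWeight, decay]
    | succ r hr ih =>
      have e : (transferEigenvalue l (M r) (M (r + 1)) : ℝ) * (M (r + 1) + 2).ascFactorial l =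
          (M r).descFactorial l * transferEigenvalue 0 (M r) (M (r + 1)) := by
        exact_mod_cast transferEigenvalue_mul l (M r) (M (r + 1))
      have hd : ((M r).descFactorial l : ℝ) ≤ (M r + 2).ascFactorial l * ((M r : ℝ) / (M r + 2)) := by
        rw [← mul_div_assoc, le_div_iff₀ (by positivity)]
        exact_mod_cast descFactorial_mul_le hl (M r)
      unfold leadingWeight decay at *
      rw [Finset.prod_Ico_succ_top hr, Finset.prod_Ico_succ_top hr, Finset.prod_Ico_succ_top hr,
        mul_assoc, e]
      set P := ∏ j ∈ Finset.Ico k r, (transferEigenvalue l (M j) (M (j + 1)) : ℝ)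
      have hP : 0 ≤ P := Finset.prod_nonneg fun _ _ => by positivity
      calc P * ((M r).descFactorial l * transferEigenvalue 0 (M r) (M (r + 1)))
          ≤ P * (((M r + 2).ascFactorial l * ((M r : ℝ) / (M r + 2))) *
              transferEigenvalue 0 (M r) (M (r + 1))) := by gcongr
        _ = (P * (M r + 2).ascFactorial l) * (((M r : ℝ) / (M r + 2)) *
              transferEigenvalue 0 (M r) (M (r + 1))) := by ring
        _ ≤ _ * (((M r : ℝ) / (M r + 2)) *
              transferEigenvalue 0 (M r) (M (r + 1))) :=
            mul_le_mul_of_nonneg_right ih (by positivity)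
        _ = _ := by ring
  refine le_trans (le_mul_of_one_le_right (Finset.prod_nonneg fun _ _ => by positivity) ?_) main
  exact_mod_cast Nat.ascFactorial_pos (M r + 1) l

/-! ### Asymptotics of the overlaps -/

/-- The rotation invariant pairing, written in the basis used for `gram`. -/
def invariantPairing (s i i' : ℕ) : ℂ :=
  if i + i' = s then (-1) ^ (s - i) * (i.factorial * (s - i).factorial : ℕ) / (s + 1).factorial
  else 0

/-- This is the recursion `gram_succ_sub` without the factor `M k + 2 + s`, which disappears once
`gram` is divided by the rising factorial. -/
lemma invariantPairing_succ_sub {s i i' : ℕ} (hi : i ≤ s) :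
    invariantPairing (s + 1) (i + 1) i' - invariantPairing (s + 1) i (i' + 1) =
      invariantPairing s i i' := by
  unfold invariantPairing
  by_cases h : i + i' = s
  · have h1 : i + 1 + i' = s + 1 := by omega
    have h2 : i + (i' + 1) = s + 1 := by omega
    rw [if_pos h, if_pos h1, if_pos h2, Nat.add_sub_add_right, Nat.sub_add_comm hi,
      Nat.factorial_succ (s + 1), Nat.factorial_succ i, Nat.factorial_succ (s - i)]
    have h3 : ((s - i : ℕ) : ℂ) = s - i := by push_cast [hi]; ring
    have h4 : ((s + 1).factorial : ℂ) ≠ 0 := by exact_mod_cast Nat.factorial_ne_zero _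
    have h5 : ((s + 1 + 1 : ℕ) : ℂ) ≠ 0 := Nat.cast_ne_zero.mpr (by omega)
    push_cast at h5 ⊢
    rw [h3]
    field_simp
    ring
  · have h1 : ¬(i + 1 + i' = s + 1) := by omega
    have h2 : ¬(i + (i' + 1) = s + 1) := by omega
    rw [if_neg h, if_neg h1, if_neg h2, sub_zero]

/-- On the antidiagonal `t = s` the binomials cancel the factorials and leave the expansion of `(1 -
1) ^ s`; the pairing vanishes on all others. So the pairing has no component in the top sector. -/
lemma sum_invariantPairing {s : ℕ} (hs : 1 ≤ s) (t : ℕ) :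
    (∑ i ∈ Finset.range (s + 1), ∑ i' ∈ Finset.range (s + 1),
      if i + i' = t then (s.choose i * s.choose i' : ℕ) * invariantPairing s i i' else 0) = 0 := by
  by_cases ht : t = s
  · subst ht
    have e : ∀ i ∈ Finset.range (t + 1), (∑ i' ∈ Finset.range (t + 1),
        if i + i' = t then (t.choose i * t.choose i' : ℕ) * invariantPairing t i i' else 0) =
        (1 ^ i * (-1) ^ (t - i) * t.choose i) * ((t.factorial : ℂ) / (t + 1).factorial) := by
      intro i hi
      have hi : i ≤ t := by simpa [Nat.lt_succ_iff] using hi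
      rw [Finset.sum_eq_single (t - i)]
      · rw [if_pos (by omega), invariantPairing, if_pos (by omega), Nat.choose_symm hi,
          ← Nat.choose_mul_factorial_mul_factorial hi]
        push_cast
        ring
      · intro i' _ h
        rw [if_neg (by omega)]
      · intro h
        exact absurd (Finset.mem_range.mpr (by omega)) h
    rw [Finset.sum_congr rfl e, ← Finset.sum_mul, ← add_pow]
    simp [show t ≠ 0 by omega]
  · refine Finset.sum_eq_zero fun i _ => Finset.sum_eq_zero fun i' _ => ?_
    split_ifs with h
    · rw [invariantPairing, if_neg (by omega), mul_zero]
    · rfl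

lemma norm_gram_self_le (M : ℕ → ℕ) (r : ℕ) {s m i i' q q' : ℕ} (hi : i ≤ s)
    (hq : q ≤ m) :
    ‖gram M r r (aDag r ^ q * bDag r ^ (m - q)) (aDag r ^ q' * bDag r ^ (m - q')) s i i'‖ ≤
      (s + m).factorial := by
  have e1 : bDag r ^ i * (-aDag r) ^ (s - i) * (chain M r r * (aDag r ^ q * bDag r ^ (m - q))) =
      ((-1 : ℂ) ^ (s - i)) • (aDag r ^ (s - i + q) * bDag r ^ (i + (m - q))) := by
    rw [chain_self, neg_pow, ← C_mul']
    simp only [map_pow, map_neg, map_one]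
    ring
  have e2 : aDag r ^ i' * bDag r ^ (s - i') * (chain M r r * (aDag r ^ q' * bDag r ^ (m - q'))) =
      aDag r ^ (i' + q') * bDag r ^ (s - i' + (m - q')) := by
    rw [chain_self]
    ring
  rw [gram, e1, e2, map_smul, LinearMap.smul_apply, bargmann_site, smul_eq_mul, norm_mul, norm_pow,
    norm_neg, norm_one, one_pow, one_mul]
  split_ifs with h
  · rw [Complex.norm_natCast]
    have h1 : s - i + q + (i + (m - q)) = s + m := by omega
    have h2 := Nat.factorial_mul_factorial_dvd_factorial_add (s - i + q) (i + (m - q))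
    rw [h1] at h2
    exact_mod_cast Nat.le_of_dvd (Nat.factorial_pos _) h2
  · simp

lemma gram_zero (M : ℕ → ℕ) {k r : ℕ} (hk : k ≤ r) {g g' : Fock}
    (hr : SiteHom r (M r) g') (hg : ∀ j, k ≤ j → j < r → SiteHom j 0 g)
    (hg' : ∀ j, k ≤ j → j < r → SiteHom j 0 g') :
    gram M k r g g' 0 0 0 = leadingWeight M k r * bargmann g g' := by
  have h := bargmann_chain M 0 0 0 hr hk hg hg'
  simp only [pow_zero, one_mul] at h
  simp [gram, h, leadingWeight]

/-- Induction on `s` through `norm_le_of_antidiagonal`, applied to the error: its differences are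
the errors for `s`, and its antidiagonal sums carry the decaying eigenvalues of the sector `s + 1`.
For `s = 0` the formula is exact. The constant depends on `m` and `s` only, not on the chain. -/
lemma exists_gram_bound (m s : ℕ) : ∃ K : ℝ, 0 ≤ K ∧ ∀ (M : ℕ → ℕ) (k r : ℕ), k ≤ r → M r = m →
    ∀ q ≤ m, ∀ q' ≤ m, ∀ i ≤ s, ∀ i' ≤ s,
    ‖gram M k r (aDag r ^ q * bDag r ^ (m - q)) (aDag r ^ q' * bDag r ^ (m - q')) s i i' /
          (M k + 2).ascFactorial s -
        invariantPairing s i i' * (leadingWeight M k r *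
          bargmann (aDag r ^ q * bDag r ^ (m - q)) (aDag r ^ q' * bDag r ^ (m - q')))‖ ≤
      K * (leadingWeight M k r * decay M k r) := by
  induction s with
  | zero =>
    refine ⟨0, le_rfl, ?_⟩
    intro M k r hk hm q hq q' hq' i hi i' hi'
    obtain rfl : i = 0 := by omega
    obtain rfl : i' = 0 := by omega
    rw [gram_zero M hk ((siteHom_monomial r q' (m - q')).congr (by omega))
      (fun j _ h => siteHom_monomial_of_ne h.ne _ _) (fun j _ h => siteHom_monomial_of_ne h.ne _ _)]
    simp [invariantPairing]
  | succ s ih =>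
    obtain ⟨K, hK0, hK⟩ := ih
    set K' : ℝ := ∑ i ∈ Finset.range (s + 1 + 1), ∑ i' ∈ Finset.range (s + 1 + 1),
      (((s + 1).choose i * (s + 1).choose i' : ℕ) : ℝ) * (s + 1 + m).factorial with hK'
    have hK'0 : 0 ≤ K' := Finset.sum_nonneg fun i _ => Finset.sum_nonneg fun i' _ => by positivity
    refine ⟨K' + (s + 1 : ℕ) * K, by positivity, ?_⟩
    intro M k r hk hm q hq q' hq' i hi i' hi'
    set g := aDag r ^ q * bDag r ^ (m - q) with hg
    set g' := aDag r ^ q' * bDag r ^ (m - q') with hg'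
    have hr : SiteHom r (M r) g' := (siteHom_monomial r q' (m - q')).congr (by omega)
    have hn : ∀ j, k ≤ j → j < r → SiteHom j 0 g := fun j _ h => siteHom_monomial_of_ne h.ne _ _
    have hn' : ∀ j, k ≤ j → j < r → SiteHom j 0 g' := fun j _ h => siteHom_monomial_of_ne h.ne _ _
    set B := leadingWeight M k r * decay M k r with hB
    have hB0 : 0 ≤ B := mul_nonneg (leadingWeight_pos M k r).le (decay_nonneg M k r)
    have hasc : ∀ s, 0 < ((M k + 2).ascFactorial s : ℝ) := fun s => by
      exact_mod_cast Nat.ascFactorial_pos (M k + 1) s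
    have hascC : ∀ s, ((M k + 2).ascFactorial s : ℂ) ≠ 0 := fun s => by
      exact_mod_cast (hasc s).ne'
    set N := (leadingWeight M k r : ℂ) * bargmann g g' with hN
    have := norm_le_of_antidiagonal (m := s + 1) (m' := s + 1) (δ := K * B) (η := K' * B)
      (e := fun i i' => gram M k r g g' (s + 1) i i' / (M k + 2).ascFactorial (s + 1) -
        invariantPairing (s + 1) i i' * N) (by positivity) ?_ ?_ hi hi'
    · refine this.trans (le_of_eq ?_)
      ring
    · intro i hi i' hi'
      have h := hK M k r hk hm q hq q' hq' i (by omega) i' (by omega)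
      refine le_trans (le_of_eq ?_) h
      congr 1
      have h1 := gram_succ_sub M hk (g := g) hr hn' (s := s) (i := i) (i' := i')
        (by omega) (by omega)
      rw [← invariantPairing_succ_sub (s := s) (i := i) (i' := i') (by omega)]
      have h2 : gram M k r g g' s i i' / ((M k + 2).ascFactorial s : ℂ) =
          (gram M k r g g' (s + 1) (i + 1) i' - gram M k r g g' (s + 1) i (i' + 1)) /
            ((M k + 2).ascFactorial (s + 1) : ℂ) := by
        rw [h1, Nat.ascFactorial_succ, Nat.cast_mul, mul_div_mul_left]
        exact_mod_cast (by omega : M k + 2 + s ≠ 0)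
      rw [h2]
      ring
    · intro t
      have h0 := sum_invariantPairing (s := s + 1) (by omega) t
      have h1 := gram_antidiagonal M hk hr hn hn' (s + 1) t
      have e : (∑ i ∈ Finset.range (s + 1 + 1), ∑ i' ∈ Finset.range (s + 1 + 1),
          if i + i' = t then (((s + 1).choose i * (s + 1).choose i' : ℕ) : ℂ) *
            (gram M k r g g' (s + 1) i i' / (M k + 2).ascFactorial (s + 1) -
              invariantPairing (s + 1) i i' * N) else 0) =
          (∑ i ∈ Finset.range (s + 1 + 1), ∑ i' ∈ Finset.range (s + 1 + 1),
            if i + i' = t then (((s + 1).choose i * (s + 1).choose i' : ℕ) : ℂ) *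
              gram M k r g g' (s + 1) i i' else 0) / (M k + 2).ascFactorial (s + 1) -
          (∑ i ∈ Finset.range (s + 1 + 1), ∑ i' ∈ Finset.range (s + 1 + 1),
            if i + i' = t then (((s + 1).choose i * (s + 1).choose i' : ℕ) : ℂ) *
              invariantPairing (s + 1) i i' else 0) * N := by
        simp only [Finset.sum_div, Finset.sum_mul, ← Finset.sum_sub_distrib]
        refine Finset.sum_congr rfl fun i _ => Finset.sum_congr rfl fun i' _ => ?_
        split_ifs
        · ring
        · simp
      rw [e, h0, h1, zero_mul, sub_zero, norm_div, norm_mul, Complex.norm_natCast,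
        div_le_iff₀ (hasc _)]
      have b1 : ‖∏ j ∈ Finset.Ico k r,
          ((-1) ^ (s + 1) * (transferEigenvalue (s + 1) (M j) (M (j + 1)) : ℂ))‖ ≤
          (M k + 2).ascFactorial (s + 1) * B := by
        rw [norm_prod]
        refine le_trans (le_of_eq ?_) (prod_transferEigenvalue_le M (l := s + 1) (by omega) hk)
        refine Finset.prod_congr rfl fun j _ => ?_
        rw [norm_mul, norm_pow, norm_neg, norm_one, one_pow, one_mul, Complex.norm_natCast]
      have b2 : ‖∑ i ∈ Finset.range (s + 1 + 1), ∑ i' ∈ Finset.range (s + 1 + 1),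
          if i + i' = t then (((s + 1).choose i * (s + 1).choose i' : ℕ) : ℂ) *
            gram M r r g g' (s + 1) i i' else 0‖ ≤ K' := by
        refine norm_sum_le_of_le _ fun i hi => norm_sum_le_of_le _ fun i' hi' => ?_
        split_ifs
        · rw [norm_mul, Complex.norm_natCast]
          refine mul_le_mul_of_nonneg_left ?_ (by positivity)
          exact norm_gram_self_le M r (by simp at hi; omega) hq
        · rw [norm_zero]; positivity
      calc _ ≤ ((M k + 2).ascFactorial (s + 1) * B) * K' :=
            mul_le_mul b1 b2 (norm_nonneg _) (by positivity)
        _ = _ := by ring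

/-- The block state with `s` and `m` additional bosons at its ends, in the monomial basis. -/
def blockPoly (M : ℕ → ℕ) (k r s m p q : ℕ) : Fock :=
  bDag k ^ p * (-aDag k) ^ (s - p) * (chain M k r * (aDag r ^ q * bDag r ^ (m - q)))

/-- The asymptotic scale of the overlaps of the block states. -/
def overlapScale (M : ℕ → ℕ) (k r s : ℕ) : ℝ :=
  (M k + 2).ascFactorial s * leadingWeight M k r / (s + 1).factorial

lemma overlapScale_pos (M : ℕ → ℕ) (k r s : ℕ) : 0 < overlapScale M k r s := by
  have h1 := leadingWeight_pos M k r
  have h2 : 0 < ((M k + 2).ascFactorial s : ℝ) := by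
    exact_mod_cast Nat.ascFactorial_pos (M k + 1) s
  unfold overlapScale
  positivity

/-- Up to sign this is `gram` at `i' = s - p'`, where the support condition of `invariantPairing`
becomes `p = p'` and its sign cancels the other one. -/
lemma exists_bargmann_blockPoly_bound (m s : ℕ) : ∃ K : ℝ, 0 ≤ K ∧ ∀ (M : ℕ → ℕ) (k r : ℕ),
    k ≤ r → M r = m → ∀ p ≤ s, ∀ p' ≤ s, ∀ q ≤ m, ∀ q' ≤ m,
    ‖bargmann (blockPoly M k r s m p q) (blockPoly M k r s m p' q') / overlapScale M k r s -
        if p = p' ∧ q = q' then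
          ((p.factorial * (s - p).factorial * (q.factorial * (m - q).factorial) : ℕ) : ℂ) else 0‖ ≤
      K * decay M k r := by
  obtain ⟨K, hK0, hK⟩ := exists_gram_bound m s
  refine ⟨(s + 1).factorial * K, by positivity, ?_⟩
  intro M k r hk hm p hp p' hp' q hq q' hq'
  have h := hK M k r hk hm q hq q' hq' p hp (s - p') (by omega)
  have e1 : blockPoly M k r s m p' q' = ((-1 : ℂ) ^ (s - p')) • (aDag k ^ (s - p') *
      bDag k ^ (s - (s - p')) * (chain M k r * (aDag r ^ q' * bDag r ^ (m - q')))) := by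
    rw [blockPoly, neg_pow, ← C_mul', Nat.sub_sub_self hp']
    simp only [map_pow, map_neg, map_one]
    ring
  rw [bargmann_site] at h
  rw [e1, map_smul, smul_eq_mul]
  change ‖(-1) ^ (s - p') * gram M k r _ _ s p (s - p') / _ - _‖ ≤ _
  have hL := leadingWeight_pos M k r
  have hA : 0 < ((M k + 2).ascFactorial s : ℝ) := by
    exact_mod_cast Nat.ascFactorial_pos (M k + 1) s
  have hL' : (leadingWeight M k r : ℂ) ≠ 0 := by exact_mod_cast hL.ne'
  have hA' : ((M k + 2).ascFactorial s : ℂ) ≠ 0 := by exact_mod_cast hA.ne'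
  have hF' : ((s + 1).factorial : ℂ) ≠ 0 := by exact_mod_cast Nat.factorial_ne_zero _
  generalize gram M k r (aDag r ^ q * bDag r ^ (m - q)) (aDag r ^ q' * bDag r ^ (m - q')) s p
    (s - p') = G at h ⊢
  have hsq : ∀ n, ((-1 : ℂ) ^ n) * (-1) ^ n = 1 := fun n => by
    rw [← mul_pow]; simp
  have hqq : (q = q' ∧ m - q = m - q') ↔ q = q' := by constructor <;> [exact And.left; (rintro rfl; simp)]
  have hpp : p + (s - p') = s ↔ p = p' := by omega
  have e2 : (-1) ^ (s - p') * G / (overlapScale M k r s : ℂ) -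
      (if p = p' ∧ q = q' then
          ((p.factorial * (s - p).factorial * (q.factorial * (m - q).factorial) : ℕ) : ℂ) else 0) =
      ((-1) ^ (s - p') * (s + 1).factorial / leadingWeight M k r) *
      (G / (M k + 2).ascFactorial s - invariantPairing s p (s - p') * (leadingWeight M k r *
        if q = q' ∧ m - q = m - q' then ((q.factorial * (m - q).factorial : ℕ) : ℂ) else 0)) := by
    rw [overlapScale, invariantPairing]
    simp only [hqq, hpp]
    push_cast
    by_cases h1 : p = p' <;> by_cases h2 : q = q'
    · subst h1 h2
      simp only [and_self, if_true]
      field_simp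
      linear_combination ((M k + 2).ascFactorial s * leadingWeight M k r * p.factorial *
        (s - p).factorial * q.factorial * (m - q).factorial : ℂ) * hsq (s - p)
    all_goals
      simp only [h1, h2, and_false, and_true, if_false, if_true]
      field_simp
      try ring
  rw [e2, norm_mul, norm_div, norm_mul, norm_pow, norm_neg, norm_one, one_pow, one_mul,
    Complex.norm_natCast, Complex.norm_real, Real.norm_of_nonneg hL.le]
  calc _ ≤ ((s + 1).factorial / leadingWeight M k r) *
        (K * (leadingWeight M k r * decay M k r)) := by gcongr
    _ = _ := by field_simp

lemma one_add_sum_le_prod {ι : Type*} (s : Finset ι) {f : ι → ℝ} (hf : ∀ i ∈ s, 0 ≤ f i) :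
    1 + ∑ i ∈ s, f i ≤ ∏ i ∈ s, (1 + f i) := by
  classical
  induction s using Finset.induction_on with
  | empty => simp
  | insert a s ha ih =>
    rw [Finset.sum_insert ha, Finset.prod_insert ha]
    have h1 := ih fun i hi => hf i (by simp [hi])
    have h2 := hf a (by simp)
    have h3 : 0 ≤ ∑ i ∈ s, f i := Finset.sum_nonneg fun i hi => hf i (by simp [hi])
    nlinarith

lemma decay_le (M : ℕ → ℕ) (k r : ℕ) :
    decay M k r ≤ (1 + ∑ j ∈ Finset.Ico k r, (1 : ℝ) / M j)⁻¹ := by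
  have h1 : decay M k r ≤ ∏ j ∈ Finset.Ico k r, (1 + (1 : ℝ) / M j)⁻¹ := by
    refine Finset.prod_le_prod (fun _ _ => by positivity) fun j _ => ?_
    -- For `M j = 0` the convention `1 / 0 = 0` makes the right factor 1, while the left one is 0.
    rcases Nat.eq_zero_or_pos (M j) with h | h
    · simp [h]
    · have : (0 : ℝ) < M j := by exact_mod_cast h
      rw [show (1 + (1 : ℝ) / M j)⁻¹ = M j / (M j + 1) by field_simp]
      gcongr
      norm_num
  refine h1.trans ?_
  rw [Finset.prod_inv_distrib]
  have hs : 0 ≤ ∑ j ∈ Finset.Ico k r, (1 : ℝ) / M j := Finset.sum_nonneg fun _ _ => by positivity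
  gcongr
  exact one_add_sum_le_prod _ fun _ _ => by positivity

/-! ### From polynomials to spin states -/

section SpinSpace

variable {d : ℕ → ℕ} {s t : Finset ℕ}

lemma occupation_zero (x : Config d s) {j : ℕ} (hj : j ∈ s) :
    occupation x (j, 0) = x ⟨j, hj⟩ := by
  simp only [occupation, Finsupp.finsetSum_apply, Finsupp.add_apply, Finsupp.single_apply,
    Prod.mk.injEq]
  rw [Finset.sum_eq_single ⟨j, hj⟩]
  · simp
  · rintro ⟨i, hi⟩ _ h
    have : i ≠ j := fun h' => h (Subtype.ext h')
    simp [this]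
  · simp

lemma occupation_one (x : Config d s) {j : ℕ} (hj : j ∈ s) :
    occupation x (j, 1) = d j - x ⟨j, hj⟩ := by
  simp only [occupation, Finsupp.finsetSum_apply, Finsupp.add_apply, Finsupp.single_apply,
    Prod.mk.injEq]
  rw [Finset.sum_eq_single ⟨j, hj⟩]
  · simp
  · rintro ⟨i, hi⟩ _ h
    have : i ≠ j := fun h' => h (Subtype.ext h')
    simp [this]
  · simp

lemma occupation_of_notMem (x : Config d s) {j : ℕ} (hj : j ∉ s) (c : Fin 2) :
    occupation x (j, c) = 0 := by
  simp only [occupation, Finsupp.finsetSum_apply, Finsupp.add_apply, Finsupp.single_apply,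
    Prod.mk.injEq]
  refine Finset.sum_eq_zero ?_
  rintro ⟨i, hi⟩ _
  have : i ≠ j := fun h' => hj (h' ▸ hi)
  simp [this]

lemma occupation_injective : Function.Injective (occupation : Config d s → _) := by
  intro x y h
  ext ⟨j, hj⟩
  rw [← occupation_zero x hj, ← occupation_zero y hj, h]

lemma occupation_prod (x : Config d s) :
    ((occupation x).prod fun _ e => e.factorial) =
      ∏ j : s, ((x j : ℕ).factorial * (d j - (x j : ℕ)).factorial) := by
  rw [Finsupp.prod_of_support_subset (s := s ×ˢ Finset.univ)]
  · rw [Finset.prod_product, ← Finset.prod_coe_sort]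
    refine Finset.prod_congr rfl fun j _ => ?_
    rw [Fin.prod_univ_two, occupation_zero x j.2, occupation_one x j.2]
  · rintro ⟨j, c⟩ h
    by_contra h'
    simp at h'
    exact (Finsupp.mem_support_iff.mp h) (occupation_of_notMem x h' c)
  · simp

lemma exists_occupation_eq {m : (ℕ × Fin 2) →₀ ℕ}
    (hm : ∀ j, m (j, 0) + m (j, 1) = if j ∈ s then d j else 0) :
    ∃ x : Config d s, occupation x = m := by
  have h : ∀ j : s, m (j, 0) + m (j, 1) = d j := fun j => by simpa using hm j
  refine ⟨fun j => ⟨m (j, 0), by have := h j; omega⟩, ?_⟩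
  ext ⟨j, c⟩
  by_cases hj : j ∈ s
  · have := h ⟨j, hj⟩
    fin_cases c
    · simp [occupation_zero _ hj]
    · simp only [Fin.mk_one, Fin.isValue, occupation_one _ hj]
      simp at this
      omega
  · rw [occupation_of_notMem _ hj]
    have := hm j
    rw [if_neg hj] at this
    fin_cases c <;> simp <;> omega

lemma toSpin_apply (p : Fock) (x : Config d s) :
    toSpin d s p x = coeff (occupation x) p *
      ((Real.sqrt (((occupation x).prod fun _ e => e.factorial : ℕ) : ℝ) : ℝ) : ℂ) := by
  rw [toSpin, occupation_prod]
  push_cast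
  rfl

lemma bargmann_eq_sum (p q : Fock) :
    bargmann p q = ∑ m ∈ p.support,
      coeff m p * ((m.prod fun _ e => e.factorial : ℕ) : ℂ) * coeff m q := by
  conv_lhs => rw [p.as_sum]
  rw [LinearMap.map_sum₂]
  refine Finset.sum_congr rfl fun m _ => ?_
  rw [← mul_one (coeff m p), ← smul_eq_mul, ← smul_monomial, map_smul, LinearMap.smul_apply,
    bargmann_monomial, Finsupp.prod, Finsupp.prod]
  push_cast
  simp [mul_assoc]

/-- The square roots in `toSpin` multiply to `m!`; homogeneity makes every monomial of `p` a basis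
label, and real coefficients make the conjugation invisible. -/
lemma inner_toSpin {p : Fock} (hp : ∀ j, SiteHom j (if j ∈ s then d j else 0) p) (q : Fock)
    (hreal : MvPolynomial.map (starRingEnd ℂ) p = p) :
    inner ℂ (toSpin d s p) (toSpin d s q) = bargmann p q := by
  classical
  have h1 : bargmann p q = ∑ m ∈ Finset.univ.image (occupation : Config d s → _),
      coeff m p * ((m.prod fun _ e => e.factorial : ℕ) : ℂ) * coeff m q := by
    rw [bargmann_eq_sum]
    refine Finset.sum_subset ?_ ?_
    · intro m hm
      obtain ⟨x, hx⟩ := exists_occupation_eq (d := d) (s := s) (m := m)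
        (fun j => (hp j).coeff (MvPolynomial.mem_support_iff.mp hm))
      exact Finset.mem_image.mpr ⟨x, Finset.mem_univ _, hx⟩
    · intro m _ hm
      rw [MvPolynomial.notMem_support_iff.mp hm]
      simp
  rw [h1, Finset.sum_image (fun _ _ _ _ h => occupation_injective h), PiLp.inner_apply]
  refine Finset.sum_congr rfl fun x _ => ?_
  rw [RCLike.inner_apply, toSpin_apply, toSpin_apply, map_mul, Complex.conj_ofReal]
  have hc : (starRingEnd ℂ) (coeff (occupation x) p) = coeff (occupation x) p := by
    rw [← coeff_map, hreal]
  rw [hc]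
  have hs : ((Real.sqrt (((occupation x).prod fun _ e => e.factorial : ℕ) : ℝ) : ℝ) : ℂ) *
      ((Real.sqrt (((occupation x).prod fun _ e => e.factorial : ℕ) : ℝ) : ℝ) : ℂ) =
      (((occupation x).prod fun _ e => e.factorial : ℕ) : ℂ) := by
    rw [← Complex.ofReal_mul, Real.mul_self_sqrt (by positivity)]
    exact Complex.ofReal_natCast _
  rw [← hs]
  ring

lemma occupation_glue (hst : s ⊆ t) (x : Config d s) (z : Config d (t \ s)) :
    occupation (glue x z) = occupation x + occupation z := by
  ext ⟨j, c⟩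
  rw [Finsupp.add_apply]
  by_cases hj : j ∈ s
  · have hz : j ∉ t \ s := by simp [hj]
    rw [occupation_of_notMem z hz]
    fin_cases c
    · simp [occupation_zero _ hj, occupation_zero _ (hst hj), glue, hj]
    · simp [occupation_one _ hj, occupation_one _ (hst hj), glue, hj]
  · rw [occupation_of_notMem x hj]
    by_cases ht : j ∈ t
    · have hz : j ∈ t \ s := by simp [hj, ht]
      fin_cases c
      · simp [occupation_zero _ hz, occupation_zero _ ht, glue, hj]
      · simp [occupation_one _ hz, occupation_one _ ht, glue, hj]
    · rw [occupation_of_notMem _ ht, occupation_of_notMem z (by simp [ht])]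

/-- Degree 0 at a site excludes its variables, so `p` and `q` use disjoint variables and only one
splitting of `m + n` contributes. -/
lemma coeff_mul_of_disjoint {p q : Fock} (hp : ∀ j ∉ s, SiteHom j 0 p)
    (hq : ∀ j ∈ s, SiteHom j 0 q) {m n : (ℕ × Fin 2) →₀ ℕ} (hm : ∀ j ∉ s, ∀ c, m (j, c) = 0)
    (hn : ∀ j ∈ s, ∀ c, n (j, c) = 0) : coeff (m + n) (p * q) = coeff m p * coeff n q := by
  classical
  rw [coeff_mul, Finset.sum_eq_single (m, n)]
  · rintro ⟨u, v⟩ huv hne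
    rw [Finset.HasAntidiagonal.mem_antidiagonal] at huv
    change u + v = m + n at huv
    by_contra hcon
    have hu : coeff u p ≠ 0 := left_ne_zero_of_mul hcon
    have hv : coeff v q ≠ 0 := right_ne_zero_of_mul hcon
    have hum : u = m := by
      ext ⟨j, c⟩
      have e := DFunLike.congr_fun huv (j, c)
      simp only [Finsupp.add_apply] at e
      by_cases hj : j ∈ s
      · have h1 := hn j hj c
        have h2 := (hq j hj).coeff hv
        have h3 : v (j, c) = 0 := by fin_cases c <;> simp <;> omega
        omega
      · have h1 := hm j hj c
        have h2 := (hp j hj).coeff hu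
        have h3 : u (j, c) = 0 := by fin_cases c <;> simp <;> omega
        omega
    subst hum
    have hvn : v = n := add_left_cancel (a := u) huv
    exact hne (by rw [hvn])
  · intro h
    rw [Finset.HasAntidiagonal.mem_antidiagonal] at h
    exact absurd rfl h

lemma toSpin_mul_glue (hst : s ⊆ t) {p q : Fock} (hp : ∀ j ∉ s, SiteHom j 0 p)
    (hq : ∀ j ∈ s, SiteHom j 0 q) (x : Config d s) (z : Config d (t \ s)) :
    toSpin d t (p * q) (glue x z) = toSpin d s p x * toSpin d (t \ s) q z := by
  have hm : ∀ j ∉ s, ∀ c, occupation x (j, c) = 0 := fun j hj c => occupation_of_notMem x hj c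
  have hn : ∀ j ∈ s, ∀ c, occupation z (j, c) = 0 :=
    fun j hj c => occupation_of_notMem z (by simp [hj]) c
  rw [toSpin_apply, toSpin_apply, toSpin_apply, occupation_glue hst,
    coeff_mul_of_disjoint hp hq hm hn, Finsupp.prod_add_index_of_disjoint]
  · rw [Nat.cast_mul, Real.sqrt_mul (by positivity), Complex.ofReal_mul]
    ring
  · rw [Finset.disjoint_left]
    rintro ⟨j, c⟩ h1 h2
    rw [Finsupp.mem_support_iff] at h1 h2
    by_cases hj : j ∈ s
    · exact h2 (hn j hj c)
    · exact h1 (hm j hj c)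

lemma sum_glue (hst : s ⊆ t) {E : Type*} [AddCommMonoid E] (f : Config d t → E) :
    ∑ X, f X = ∑ x : Config d s, ∑ z : Config d (t \ s), f (glue x z) := by
  rw [← Fintype.sum_prod_type']
  refine (Fintype.sum_bijective (fun xz : Config d s × Config d (t \ s) => glue xz.1 xz.2)
    ⟨?_, ?_⟩ _ _ fun _ => rfl).symm
  · rintro ⟨x, z⟩ ⟨x', z'⟩ h
    simp only at h
    refine Prod.ext ?_ ?_
    · funext ⟨j, hj⟩
      have := congrFun h ⟨j, hst hj⟩
      simpa [glue, hj] using this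
    · funext ⟨j, hj⟩
      have hj' := Finset.mem_sdiff.mp hj
      have := congrFun h ⟨j, hj'.1⟩
      simpa [glue, hj'.2] using this
  · intro X
    refine ⟨(fun j => X ⟨j, hst j.2⟩, fun j => X ⟨j, (Finset.mem_sdiff.mp j.2).1⟩), ?_⟩
    funext ⟨j, hj⟩
    by_cases h : j ∈ s <;> simp [glue, h]

lemma toSpin_add (p q : Fock) : toSpin d s (p + q) = toSpin d s p + toSpin d s q := by
  ext x; simp [toSpin, add_mul]

lemma toSpin_smul (c : ℂ) (p : Fock) : toSpin d s (c • p) = c • toSpin d s p := by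
  ext x; simp [toSpin, mul_assoc]

variable (d s) in
/-- `toSpin` as a linear map. -/
def toSpinLinear : Fock →ₗ[ℂ] SpinSpace d s where
  toFun := toSpin d s
  map_add' := toSpin_add
  map_smul' := toSpin_smul

lemma toSpin_sum {ι : Type*} (u : Finset ι) (p : ι → Fock) :
    toSpin d s (∑ i ∈ u, p i) = ∑ i ∈ u, toSpin d s (p i) :=
  map_sum (toSpinLinear d s) p u

end SpinSpace

/-! ### Splitting the VBS state into block and environment -/

/-- `p` has real coefficients. -/
def IsRealPoly (p : Fock) : Prop := MvPolynomial.map (starRingEnd ℂ) p = p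

lemma isRealPoly_chain (M : ℕ → ℕ) (k r : ℕ) : IsRealPoly (chain M k r) := by
  simp [IsRealPoly, chain, bond, aDag, bDag, map_prod]

lemma isRealPoly_aDag (j : ℕ) : IsRealPoly (aDag j) := by simp [IsRealPoly, aDag]

lemma isRealPoly_bDag (j : ℕ) : IsRealPoly (bDag j) := by simp [IsRealPoly, bDag]

lemma IsRealPoly.mul {p q : Fock} (hp : IsRealPoly p) (hq : IsRealPoly q) :
    IsRealPoly (p * q) := by
  unfold IsRealPoly at *; rw [map_mul, hp, hq]

lemma IsRealPoly.pow {p : Fock} (hp : IsRealPoly p) (n : ℕ) : IsRealPoly (p ^ n) := by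
  unfold IsRealPoly at *; rw [map_pow, hp]

lemma IsRealPoly.neg {p : Fock} (hp : IsRealPoly p) : IsRealPoly (-p) := by
  unfold IsRealPoly at *; rw [map_neg, hp]

/-- Contracting a chain from its right end. -/
lemma exists_bargmann_mul_chain (M : ℕ → ℕ) {a b : ℕ} (hab : a ≤ b) :
    ∃ κ : ℝ, 0 < κ ∧ ∀ f f' : Fock, SiteHom a (M (a - 1)) f' →
      (∀ j, a < j → j ≤ b → SiteHom j 0 f') →
      bargmann (f * chain M a b) (f' * chain M a b) = κ * bargmann f f' := by
  induction b, hab using Nat.le_induction with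
  | base => exact ⟨1, one_pos, fun f f' _ _ => by simp [chain_self]⟩
  | succ b hb ih =>
    obtain ⟨κ, hκ, h⟩ := ih
    -- `M (b - 1)` is the degree left at `b` once the bonds to `b + 1` are removed.
    refine ⟨((M b).factorial * (M (b - 1) + 2).ascFactorial (M b) : ℕ) * κ, ?_, ?_⟩
    · have := Nat.ascFactorial_pos (M (b - 1) + 1) (M b)
      positivity
    · intro f f' hf hf'
      have h1 : SiteHom (b + 1) 0 (f' * chain M a b) :=
        ((hf' (b + 1) (by omega) le_rfl).mul (siteHom_chain M hb (b + 1))).congr (by simp)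
      have h2 : SiteHom b (M (b - 1)) (f' * chain M a b) := by
        rcases hb.eq_or_lt with h | h
        · subst h
          simpa [chain_self] using hf
        · exact ((hf' b h (by omega)).mul (siteHom_chain M hb b)).congr (by simp [h])
      have e : ∀ f, f * chain M a (b + 1) =
          ((-1 : ℂ) ^ M b) • (bond (b + 1) b ^ M b * (f * chain M a b)) := by
        intro f
        rw [chain_succ_top M hb, ← C_mul',
          show bond b (b + 1) = (-1) * bond (b + 1) b by unfold bond; ring, mul_pow]
        simp only [map_pow, map_neg, map_one]
        ring
      rw [e, e, map_smul, map_smul, LinearMap.smul_apply,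
        bargmann_bond_pow (by omega) h1 h2, h f f' hf (fun j h3 h4 => hf' j h3 (by omega)),
        smul_eq_mul, smul_eq_mul, ← mul_assoc, ← mul_pow]
      push_cast
      ring

namespace ChainBlock

variable (C : ChainBlock)

lemma one_le_first : 1 ≤ C.first := C.one_le_k

lemma first_le_last : C.first ≤ C.last := by
  have := C.one_le_L
  unfold first last
  omega

lemma last_le : C.last ≤ C.N := by
  have := C.block_le
  have := C.one_le_L
  unfold last
  omega

lemma leftBond_eq : C.leftBond = C.M (C.first - 1) := rfl

lemma rightBond_eq : C.rightBond = C.M C.last := rfl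

lemma mem_block {j : ℕ} : j ∈ C.block ↔ C.first ≤ j ∧ j ≤ C.last := Finset.mem_Icc

lemma block_subset_sites : C.block ⊆ C.sites := by
  intro j hj
  have := C.mem_block.mp hj
  have := C.last_le
  simp only [sites, Finset.mem_Icc]
  omega

/-- The polynomial of the environment that accompanies `blockPoly` in the VBS state. -/
def envPoly (p q : ℕ) : Fock :=
  chain C.M 0 (C.first - 1) *
    (aDag (C.first - 1) ^ p * bDag (C.first - 1) ^ (C.leftBond - p) *
      (bDag (C.last + 1) ^ q * (-aDag (C.last + 1)) ^ (C.rightBond - q) *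
        chain C.M (C.last + 1) (C.N + 1)))

lemma vbs_poly_eq : (∏ j ∈ Finset.range (C.N + 1), bond j (j + 1) ^ C.M j) =
    ∑ p ∈ Finset.range (C.leftBond + 1), ∑ q ∈ Finset.range (C.rightBond + 1),
      ((C.leftBond.choose p * C.rightBond.choose q : ℕ) : ℂ) •
        (blockPoly C.M C.first C.last C.leftBond C.rightBond p q * C.envPoly p q) := by
  have h1 := C.one_le_first
  have h2 := C.first_le_last
  have h3 := C.last_le
  have e1 : (∏ j ∈ Finset.range (C.N + 1), bond j (j + 1) ^ C.M j) =
      chain C.M 0 (C.first - 1) * bond (C.first - 1) C.first ^ C.leftBond *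
        (chain C.M C.first C.last * (bond C.last (C.last + 1) ^ C.rightBond *
          chain C.M (C.last + 1) (C.N + 1))) := by
    have a1 : chain C.M 0 C.first =
        chain C.M 0 (C.first - 1) * bond (C.first - 1) C.first ^ C.leftBond := by
      have := chain_succ_top C.M (Nat.zero_le (C.first - 1))
      rwa [Nat.sub_add_cancel h1] at this
    have a2 : chain C.M C.last (C.N + 1) =
        bond C.last (C.last + 1) ^ C.rightBond * chain C.M (C.last + 1) (C.N + 1) :=
      chain_eq_mul C.M (by omega)
    rw [← a1, ← a2, ← Nat.Ico_zero_eq_range]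
    unfold chain
    rw [Finset.prod_Ico_consecutive _ h2 (by omega), Finset.prod_Ico_consecutive _ (by omega) (by omega)]
  have b1 : bond (C.first - 1) C.first ^ C.leftBond = ∑ p ∈ Finset.range (C.leftBond + 1),
      aDag (C.first - 1) ^ p * bDag (C.first - 1) ^ (C.leftBond - p) *
        (bDag C.first ^ p * (-aDag C.first) ^ (C.leftBond - p)) * C.leftBond.choose p := by
    rw [show bond (C.first - 1) C.first = aDag (C.first - 1) * bDag C.first +
      bDag (C.first - 1) * (-aDag C.first) by unfold bond; ring, add_pow]
    refine Finset.sum_congr rfl fun p _ => ?_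
    rw [mul_pow, mul_pow]; ring
  have b2 : bond C.last (C.last + 1) ^ C.rightBond = ∑ q ∈ Finset.range (C.rightBond + 1),
      aDag C.last ^ q * bDag C.last ^ (C.rightBond - q) *
        (bDag (C.last + 1) ^ q * (-aDag (C.last + 1)) ^ (C.rightBond - q)) *
          C.rightBond.choose q := by
    rw [show bond C.last (C.last + 1) = aDag C.last * bDag (C.last + 1) +
      bDag C.last * (-aDag (C.last + 1)) by unfold bond; ring, add_pow]
    refine Finset.sum_congr rfl fun p _ => ?_
    rw [mul_pow, mul_pow]; ring
  rw [e1, b1, b2, Finset.mul_sum, Finset.sum_mul]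
  refine Finset.sum_congr rfl fun p _ => ?_
  rw [Finset.sum_mul, Finset.mul_sum, Finset.mul_sum]
  refine Finset.sum_congr rfl fun q _ => ?_
  rw [← C_mul', blockPoly, envPoly]
  simp only [map_natCast]
  push_cast
  ring

lemma siteHom_blockPoly {p q : ℕ} (hp : p ≤ C.leftBond) (hq : q ≤ C.rightBond) (j : ℕ) :
    SiteHom j (if j ∈ C.block then C.twoS j else 0)
      (blockPoly C.M C.first C.last C.leftBond C.rightBond p q) := by
  have h1 := C.one_le_first
  have h2 := C.first_le_last
  have h3 := C.last_le
  refine ((((siteHom_bDag C.first j).pow p).mul ((siteHom_aDag C.first j).neg.pow _)).mul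
    ((siteHom_chain C.M h2 j).mul (((siteHom_aDag C.last j).pow q).mul
      ((siteHom_bDag C.last j).pow _)))).congr ?_
  have e1 : ∀ c, p * c + (C.leftBond - p) * c = C.leftBond * c := fun c => by
    rw [← add_mul, Nat.add_sub_of_le hp]
  have e2 : ∀ c, q * c + (C.rightBond - q) * c = C.rightBond * c := fun c => by
    rw [← add_mul, Nat.add_sub_of_le hq]
  rw [e1, e2, C.leftBond_eq, C.rightBond_eq]
  simp only [C.mem_block, twoS]
  by_cases hj : C.first ≤ j ∧ j ≤ C.last
  · have hj0 : j ≠ 0 := by omega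
    have hjN : j ≠ C.N + 1 := by omega
    simp only [hj, hj0, hjN, true_and, and_true, if_true, if_false]
    rcases hj.1.eq_or_lt with ha | ha <;> rcases hj.2.eq_or_lt with hb | hb
    · subst hb; simp [← ha]
    · subst ha; simp [hb, hb.ne]
    · subst hb; simp [ha, ha.ne']
    · simp [ha, hb, ha.ne', hb.ne]
  · have a1 : j ≠ C.first := by omega
    have a2 : j ≠ C.last := by omega
    have a3 : ¬(C.first < j ∧ j ≤ C.last) := by omega
    have a4 : ¬(C.first ≤ j ∧ j < C.last) := by omega
    simp [hj, a1, a2, a3, a4]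

lemma siteHom_envPoly {p q : ℕ} (hp : p ≤ C.leftBond) (hq : q ≤ C.rightBond) (j : ℕ) :
    SiteHom j (if j ∈ C.sites \ C.block then C.twoS j else 0) (C.envPoly p q) := by
  have h1 := C.one_le_first
  have h2 := C.first_le_last
  have h3 := C.last_le
  refine ((siteHom_chain C.M (Nat.zero_le (C.first - 1)) j).mul
    ((((siteHom_aDag (C.first - 1) j).pow p).mul ((siteHom_bDag (C.first - 1) j).pow _)).mul
    ((((siteHom_bDag (C.last + 1) j).pow q).mul ((siteHom_aDag (C.last + 1) j).neg.pow _)).mul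
      (siteHom_chain C.M (show C.last + 1 ≤ C.N + 1 by omega) j)))).congr ?_
  have e1 : ∀ c, p * c + (C.leftBond - p) * c = C.leftBond * c := fun c => by
    rw [← add_mul, Nat.add_sub_of_le hp]
  have e2 : ∀ c, q * c + (C.rightBond - q) * c = C.rightBond * c := fun c => by
    rw [← add_mul, Nat.add_sub_of_le hq]
  rw [e1, e2, C.leftBond_eq, C.rightBond_eq]
  simp only [Finset.mem_sdiff, C.mem_block, sites, Finset.mem_Icc, twoS]
  rcases lt_trichotomy j (C.first - 1) with h | h | h
  · have a : ∀ P : Prop, ¬(C.last + 1 < j ∧ P) := fun P => by omega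
    have b : ¬(C.last + 1 ≤ j ∧ j < C.N + 1) := by omega
    have e : (0 ≤ j ∧ j ≤ C.N + 1) ∧ ¬(C.first ≤ j ∧ j ≤ C.last) := by omega
    rw [if_pos e, if_neg (a _), if_neg b, if_neg (show j ≠ C.first - 1 by omega),
      if_neg (show j ≠ C.last + 1 by omega), if_neg (show j ≠ C.N + 1 by omega),
      if_pos (show 0 ≤ j ∧ j < C.first - 1 by omega)]
    by_cases h0 : j = 0
    · simp [h0]
    · rw [if_pos (show 0 < j ∧ j ≤ C.first - 1 by omega), if_neg h0]; ring
  · have a : ∀ P : Prop, ¬(C.last + 1 < j ∧ P) := fun P => by omega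
    have b : ¬(C.last + 1 ≤ j ∧ j < C.N + 1) := by omega
    have e : (0 ≤ j ∧ j ≤ C.N + 1) ∧ ¬(C.first ≤ j ∧ j ≤ C.last) := by omega
    rw [if_pos e, if_neg (a _), if_neg b, if_pos h,
      if_neg (show j ≠ C.last + 1 by omega), if_neg (show j ≠ C.N + 1 by omega),
      if_neg (show ¬(0 ≤ j ∧ j < C.first - 1) by omega), h]
    by_cases h0 : C.first - 1 = 0
    · simp [h0]
    · rw [if_pos (show 0 < C.first - 1 ∧ C.first - 1 ≤ C.first - 1 by omega), if_neg h0]; ring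
  · rw [if_neg (show ¬(0 < j ∧ j ≤ C.first - 1) by omega),
      if_neg (show ¬(0 ≤ j ∧ j < C.first - 1) by omega), if_neg (show j ≠ C.first - 1 by omega),
      if_neg (show j ≠ 0 by omega)]
    rcases lt_trichotomy j (C.last + 1) with h' | h' | h'
    · have e : ¬((0 ≤ j ∧ j ≤ C.N + 1) ∧ ¬(C.first ≤ j ∧ j ≤ C.last)) := by omega
      rw [if_neg e, if_neg (show ¬(C.last + 1 < j ∧ j ≤ C.N + 1) by omega),
        if_neg (show ¬(C.last + 1 ≤ j ∧ j < C.N + 1) by omega),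
        if_neg (show j ≠ C.last + 1 by omega)]
      simp
    · have e : (0 ≤ j ∧ j ≤ C.N + 1) ∧ ¬(C.first ≤ j ∧ j ≤ C.last) := by omega
      rw [if_pos e, if_neg (show ¬(C.last + 1 < j ∧ j ≤ C.N + 1) by omega), if_pos h']
      subst h'
      by_cases hN : C.last + 1 = C.N + 1
      · simp [show C.last = C.N by omega]
      · rw [if_pos (show C.last + 1 ≤ C.last + 1 ∧ C.last + 1 < C.N + 1 by omega), if_neg hN]
        simp
    · rw [if_neg (show j ≠ C.last + 1 by omega)]
      by_cases hN : j ≤ C.N + 1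
      · have e : (0 ≤ j ∧ j ≤ C.N + 1) ∧ ¬(C.first ≤ j ∧ j ≤ C.last) := by omega
        rw [if_pos e, if_pos (show (C.last + 1 < j ∧ j ≤ C.N + 1) by omega)]
        by_cases hN' : j = C.N + 1
        · simp [hN']
        · rw [if_pos (show C.last + 1 ≤ j ∧ j < C.N + 1 by omega), if_neg hN']; simp
      · have e : ¬((0 ≤ j ∧ j ≤ C.N + 1) ∧ ¬(C.first ≤ j ∧ j ≤ C.last)) := by omega
        rw [if_neg e, if_neg (show ¬(C.last + 1 < j ∧ j ≤ C.N + 1) by omega),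
          if_neg (show ¬(C.last + 1 ≤ j ∧ j < C.N + 1) by omega)]
        simp

lemma isRealPoly_blockPoly (p q : ℕ) :
    IsRealPoly (blockPoly C.M C.first C.last C.leftBond C.rightBond p q) :=
  (((isRealPoly_bDag _).pow _).mul ((isRealPoly_aDag _).neg.pow _)).mul
    ((isRealPoly_chain _ _ _).mul (((isRealPoly_aDag _).pow _).mul ((isRealPoly_bDag _).pow _)))

lemma isRealPoly_envPoly (p q : ℕ) : IsRealPoly (C.envPoly p q) :=
  (isRealPoly_chain _ _ _).mul ((((isRealPoly_aDag _).pow _).mul ((isRealPoly_bDag _).pow _)).mul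
    ((((isRealPoly_bDag _).pow _).mul ((isRealPoly_aDag _).neg.pow _)).mul
      (isRealPoly_chain _ _ _)))

/-- Both outer pieces end freely, so contracting each from its outer end costs only a scalar
(`gram_zero` on the left, `exists_bargmann_mul_chain` on the right). The monomials left at the two
cut ends are exactly orthogonal. -/
lemma exists_bargmann_envPoly : ∃ κ : ℝ, 0 < κ ∧ ∀ p ≤ C.leftBond, ∀ p' ≤ C.leftBond,
    ∀ q ≤ C.rightBond, ∀ q' ≤ C.rightBond,
    bargmann (C.envPoly p q) (C.envPoly p' q') =
      if p = p' ∧ q = q' then κ * ((p.factorial * (C.leftBond - p).factorial *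
        (q.factorial * (C.rightBond - q).factorial) : ℕ) : ℂ) else 0 := by
  have h1 := C.one_le_first
  have h2 := C.first_le_last
  have h3 := C.last_le
  obtain ⟨κ, hκ, hr⟩ := exists_bargmann_mul_chain C.M (a := C.last + 1) (b := C.N + 1)
    (by omega)
  refine ⟨leadingWeight C.M 0 (C.first - 1) * κ, mul_pos (leadingWeight_pos _ _ _) hκ, ?_⟩
  intro p hp p' hp' q hq q' hq'
  set R : ℕ → Fock := fun q => bDag (C.last + 1) ^ q * (-aDag (C.last + 1)) ^ (C.rightBond - q) *
        chain C.M (C.last + 1) (C.N + 1) with hR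
  have hRs : ∀ q, ∀ j < C.last + 1, SiteHom j 0 (R q) := by
    intro q j hj
    refine ((((siteHom_bDag (C.last + 1) j).pow q).mul ((siteHom_aDag (C.last + 1) j).neg.pow _)).mul
      (siteHom_chain C.M (show C.last + 1 ≤ C.N + 1 by omega) j)).congr ?_
    rw [if_neg (show j ≠ C.last + 1 by omega),
      if_neg (show ¬(C.last + 1 < j ∧ j ≤ C.N + 1) by omega),
      if_neg (show ¬(C.last + 1 ≤ j ∧ j < C.N + 1) by omega)]
    simp
  set G : ℕ → ℕ → Fock := fun p q =>
    aDag (C.first - 1) ^ p * bDag (C.first - 1) ^ (C.leftBond - p) * R q with hG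
  have hGs : ∀ p q j, j < C.first - 1 → SiteHom j 0 (G p q) := fun p q j hj =>
    ((siteHom_monomial_of_ne hj.ne _ _).mul (hRs q j (by omega))).congr (by simp)
  have hGd : SiteHom (C.first - 1) (C.M (C.first - 1)) (G p' q') :=
    ((siteHom_monomial _ _ _).mul (hRs q' _ (by omega))).congr
      (by rw [← C.leftBond_eq]; omega)
  have e1 : bargmann (C.envPoly p q) (C.envPoly p' q') =
      leadingWeight C.M 0 (C.first - 1) * bargmann (G p q) (G p' q') := by
    have h := gram_zero C.M (Nat.zero_le (C.first - 1)) (g := G p q) hGd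
      (fun j _ hj => hGs p q j hj) (fun j _ hj => hGs p' q' j hj)
    rw [← h, gram]
    simp [envPoly, hG, hR]
  have e2 : bargmann (R q) (R q') =
      if q = q' then κ * ((q.factorial * (C.rightBond - q).factorial : ℕ) : ℂ) else 0 := by
    have hs : ∀ q, bDag (C.last + 1) ^ q * (-aDag (C.last + 1)) ^ (C.rightBond - q) =
        ((-1 : ℂ) ^ (C.rightBond - q)) •
          (aDag (C.last + 1) ^ (C.rightBond - q) * bDag (C.last + 1) ^ q) := by
      intro q
      rw [neg_pow, ← C_mul']
      simp only [map_pow, map_neg, map_one]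
      ring
    simp only [hR]
    rw [hr]
    · rw [hs, hs, map_smul, map_smul, LinearMap.smul_apply, bargmann_site]
      by_cases h : q = q'
      · subst h
        simp only [and_self, if_true, smul_eq_mul]
        rw [← mul_assoc ((-1) ^ _), ← mul_pow]
        push_cast
        ring
      · simp [h]
    · exact ((((siteHom_bDag _ _).pow q').mul ((siteHom_aDag _ _).neg.pow _))).congr
        (by simp only [if_true, Nat.add_sub_cancel, mul_one]; rw [← C.rightBond_eq]; omega)
    · intro j hj _
      exact ((((siteHom_bDag _ _).pow q').mul ((siteHom_aDag _ _).neg.pow _))).congr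
        (by simp [hj.ne'])
  rw [e1]
  simp only [hG]
  rw [bargmann_site_mul _ _ _ _ _ (hRs q _ (by omega)) (hRs q' _ (by omega)), e2]
  have hpp : (p = p' ∧ C.leftBond - p = C.leftBond - p') ↔ p = p' := by
    constructor
    · exact And.left
    · rintro rfl; simp
  simp only [hpp]
  by_cases a : p = p' <;> by_cases b : q = q' <;> simp [a, b]
  ring

end ChainBlock

/-- The squared norm of the monomial of the two end spins with labels `a`. -/
def endWeight (m m' : ℕ) (a : Fin (m + 1) × Fin (m' + 1)) : ℕ :=
  (a.1 : ℕ).factorial * (m - a.1).factorial * ((a.2 : ℕ).factorial * (m' - a.2).factorial)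

lemma endWeight_pos (m m' : ℕ) (a : Fin (m + 1) × Fin (m' + 1)) : 0 < endWeight m m' a := by
  unfold endWeight; positivity

/-- The binomials from the cut bonds offset the monomial norms, which is why all `envVec` have the
same norm. -/
lemma choose_sq_mul_endWeight_sq (m m' : ℕ) (a : Fin (m + 1) × Fin (m' + 1)) :
    m.choose a.1 * m'.choose a.2 * endWeight m m' a = m.factorial * m'.factorial := by
  have h1 := Nat.choose_mul_factorial_mul_factorial (Nat.lt_succ_iff.mp a.1.2)
  have h2 := Nat.choose_mul_factorial_mul_factorial (Nat.lt_succ_iff.mp a.2.2)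
  rw [← h1, ← h2, endWeight]
  ring

namespace ChainBlock

variable (C : ChainBlock)

/-- The block states obtained from the normalized monomial basis of the two end spins. -/
def blockVec (a : Fin (C.leftBond + 1) × Fin (C.rightBond + 1)) : SpinSpace C.twoS C.block :=
  (((Real.sqrt (endWeight C.leftBond C.rightBond a))⁻¹ : ℝ) : ℂ) •
    toSpin C.twoS C.block (blockPoly C.M C.first C.last C.leftBond C.rightBond a.1 a.2)

/-- The environment state that accompanies `blockVec`. -/
def envVec (a : Fin (C.leftBond + 1) × Fin (C.rightBond + 1)) :
    SpinSpace C.twoS (C.sites \ C.block) :=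
  ((C.leftBond.choose a.1 * C.rightBond.choose a.2 : ℕ) *
    ((Real.sqrt (endWeight C.leftBond C.rightBond a) : ℝ) : ℂ)) •
    toSpin C.twoS (C.sites \ C.block) (C.envPoly a.1 a.2)

lemma vbs_glue (x : Config C.twoS C.block) (z : Config C.twoS (C.sites \ C.block)) :
    C.vbs (glue x z) = ∑ a, C.blockVec a x * C.envVec a z := by
  rw [vbs, vbs_poly_eq, Finset.sum_range, Fintype.sum_prod_type, toSpin_sum, WithLp.ofLp_sum,
    Finset.sum_apply]
  refine Finset.sum_congr rfl fun p _ => ?_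
  rw [Finset.sum_range, toSpin_sum, WithLp.ofLp_sum, Finset.sum_apply]
  refine Finset.sum_congr rfl fun q _ => ?_
  have hp : (p : ℕ) ≤ C.leftBond := Nat.lt_succ_iff.mp p.2
  have hq : (q : ℕ) ≤ C.rightBond := Nat.lt_succ_iff.mp q.2
  rw [toSpin_smul, PiLp.smul_apply, toSpin_mul_glue C.block_subset_sites
    (fun j hj => (C.siteHom_blockPoly hp hq j).congr (by simp [hj]))
    (fun j hj => (C.siteHom_envPoly hp hq j).congr (by simp [hj])), blockVec, envVec,
    PiLp.smul_apply, PiLp.smul_apply]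
  have h : (Real.sqrt (endWeight C.leftBond C.rightBond (p, q)) : ℂ) ≠ 0 := by
    have := endWeight_pos C.leftBond C.rightBond (p, q)
    exact_mod_cast (Real.sqrt_pos.mpr (by exact_mod_cast this)).ne'
  simp only [smul_eq_mul]
  push_cast
  field_simp

lemma inner_blockVec (a b : Fin (C.leftBond + 1) × Fin (C.rightBond + 1)) :
    inner ℂ (C.blockVec a) (C.blockVec b) =
      (((Real.sqrt (endWeight C.leftBond C.rightBond a))⁻¹ *
        (Real.sqrt (endWeight C.leftBond C.rightBond b))⁻¹ : ℝ) : ℂ) *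
      bargmann (blockPoly C.M C.first C.last C.leftBond C.rightBond a.1 a.2)
        (blockPoly C.M C.first C.last C.leftBond C.rightBond b.1 b.2) := by
  rw [blockVec, blockVec, inner_smul_left, inner_smul_right, Complex.conj_ofReal,
    inner_toSpin (C.siteHom_blockPoly (Nat.lt_succ_iff.mp a.1.2) (Nat.lt_succ_iff.mp a.2.2)) _
      (C.isRealPoly_blockPoly _ _)]
  push_cast
  ring

lemma exists_inner_envVec : ∃ κ : ℝ, 0 < κ ∧ ∀ a b,
    inner ℂ (C.envVec a) (C.envVec b) = if a = b then (κ : ℂ) else 0 := by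
  obtain ⟨κ, hκ, h⟩ := C.exists_bargmann_envPoly
  refine ⟨κ * (C.leftBond.factorial * C.rightBond.factorial : ℕ) ^ 2, by positivity, ?_⟩
  rintro ⟨p, q⟩ ⟨p', q'⟩
  have hp : (p : ℕ) ≤ C.leftBond := Nat.lt_succ_iff.mp p.2
  have hq : (q : ℕ) ≤ C.rightBond := Nat.lt_succ_iff.mp q.2
  rw [envVec, envVec, inner_smul_left, inner_smul_right,
    inner_toSpin (C.siteHom_envPoly hp hq) _ (C.isRealPoly_envPoly _ _),
    h _ hp _ (Nat.lt_succ_iff.mp p'.2) _ hq _ (Nat.lt_succ_iff.mp q'.2)]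
  by_cases hab : (p, q) = (p', q')
  · obtain ⟨rfl, rfl⟩ := Prod.mk.injEq .. ▸ hab
    rw [if_pos rfl, if_pos ⟨rfl, rfl⟩, ← choose_sq_mul_endWeight_sq _ _ (p, q), map_mul,
      Complex.conj_natCast, Complex.conj_ofReal]
    have hs : (Real.sqrt (endWeight C.leftBond C.rightBond (p, q)) : ℂ) *
        (Real.sqrt (endWeight C.leftBond C.rightBond (p, q)) : ℂ) =
        (endWeight C.leftBond C.rightBond (p, q) : ℂ) := by
      rw [← Complex.ofReal_mul, Real.mul_self_sqrt (by positivity)]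
      exact Complex.ofReal_natCast _
    have hw : (p : ℕ).factorial * (C.leftBond - p).factorial *
        ((q : ℕ).factorial * (C.rightBond - q).factorial) =
        endWeight C.leftBond C.rightBond (p, q) := rfl
    rw [hw]
    push_cast
    linear_combination ((C.leftBond.choose p : ℂ) ^ 2 * (C.rightBond.choose q) ^ 2 * κ *
      endWeight C.leftBond C.rightBond (p, q)) * hs
  · rw [if_neg hab, if_neg, mul_zero, mul_zero]
    rintro ⟨h1, h2⟩
    exact hab (Prod.ext (Fin.ext h1) (Fin.ext h2))

end ChainBlock

/-! ### The density matrix as a mixture of block states -/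

/-- The normalized mixture of the (unnormalized) pure states `w a`. -/
def mixture {ι n : Type*} [Fintype ι] [Fintype n] (w : ι → EuclideanSpace ℂ n) : Matrix n n ℂ :=
  fun x y => (∑ a, w a x * star (w a y)) / ∑ a, inner ℂ (w a) (w a)

namespace ChainBlock

variable (C : ChainBlock)

/-- Tracing out orthogonal environment vectors removes the cross terms, and their common squared
norm `κ` cancels in the normalization. -/
lemma densityMatrix_eq : C.densityMatrix = mixture C.blockVec := by
  obtain ⟨κ, hκ, h⟩ := C.exists_inner_envVec
  have key : ∀ x y, ∑ z, C.vbs (glue x z) * star (C.vbs (glue y z)) =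
      κ * ∑ a, C.blockVec a x * star (C.blockVec a y) := by
    intro x y
    have e : ∀ z, C.vbs (glue x z) * star (C.vbs (glue y z)) = ∑ a, ∑ b,
        C.blockVec a x * star (C.blockVec b y) * (C.envVec a z * star (C.envVec b z)) := by
      intro z
      rw [vbs_glue, vbs_glue, star_sum, Finset.sum_mul_sum]
      refine Finset.sum_congr rfl fun a _ => Finset.sum_congr rfl fun b _ => ?_
      rw [star_mul']
      ring
    simp only [e]
    rw [Finset.sum_comm, Finset.mul_sum]
    refine Finset.sum_congr rfl fun a _ => ?_
    rw [Finset.sum_comm]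
    have e2 : ∀ b, ∑ z, C.blockVec a x * star (C.blockVec b y) *
        (C.envVec a z * star (C.envVec b z)) =
        C.blockVec a x * star (C.blockVec b y) * if b = a then (κ : ℂ) else 0 := by
      intro b
      rw [← Finset.mul_sum, ← h b a, PiLp.inner_apply]
      rfl
    simp only [e2]
    rw [Finset.sum_eq_single a]
    · rw [if_pos rfl]; ring
    · intro b _ hb; rw [if_neg hb, mul_zero]
    · simp
  have hZ : inner ℂ C.vbs C.vbs = (κ : ℂ) * ∑ a, inner ℂ (C.blockVec a) (C.blockVec a) := by
    rw [PiLp.inner_apply]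
    have : ∀ X, inner ℂ (C.vbs X) (C.vbs X) = C.vbs X * star (C.vbs X) := fun X => rfl
    simp only [this]
    rw [sum_glue C.block_subset_sites]
    simp only [key]
    rw [← Finset.mul_sum, Finset.sum_comm]
    refine congrArg _ (Finset.sum_congr rfl fun a _ => ?_)
    rw [PiLp.inner_apply]
    rfl
  ext x y
  rw [densityMatrix, partialTrace, mixture]
  simp only [pureState]
  rw [← Finset.sum_div, key, hZ, mul_div_mul_left]
  exact_mod_cast hκ.ne'

end ChainBlock

/-! ### The ground space is the span of the block states -/

lemma bond_ne_zero {i j : ℕ} (h : i ≠ j) : bond i j ≠ 0 := by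
  intro h0
  have := congrArg (eval fun x : ℕ × Fin 2 => if x = (i, 0) ∨ x = (j, 1) then (1 : ℂ) else 0) h0
  simp [bond, aDag, bDag, h] at this

lemma chain_ne_zero (M : ℕ → ℕ) (k r : ℕ) : chain M k r ≠ 0 :=
  Finset.prod_ne_zero_iff.mpr fun _ _ => pow_ne_zero _ (bond_ne_zero (by omega))

lemma spinor_ne_zero {u v : ℂ} (h : u ≠ 0 ∨ v ≠ 0) (j : ℕ) : spinor u v j ≠ 0 := by
  intro h0
  rcases h with h | h
  · have := congrArg (eval fun x : ℕ × Fin 2 => if x.2 = 0 then (1 : ℂ) else 0) h0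
    simp [spinor, aDag, bDag] at this
    exact h this
  · have := congrArg (eval fun x : ℕ × Fin 2 => if x.2 = 1 then (1 : ℂ) else 0) h0
    simp [spinor, aDag, bDag] at this
    exact h this

lemma spinorUV_ne_zero (θ φ : ℝ) : spinorU θ φ ≠ 0 ∨ spinorV θ φ ≠ 0 := by
  by_contra! h
  obtain ⟨h1, h2⟩ := h
  simp only [spinorU, spinorV, mul_eq_zero, Complex.exp_ne_zero, or_false] at h1 h2
  have h1 : Real.cos (θ / 2) = 0 := by exact_mod_cast h1
  have h2 : Real.sin (θ / 2) = 0 := by exact_mod_cast h2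
  have := Real.sin_sq_add_cos_sq (θ / 2)
  rw [h1, h2] at this
  norm_num at this

/-- The meridian `φ = 0` already realizes every positive ratio `u / v`, enough points to separate
the coefficients of a polynomial. -/
lemma exists_spinor_ratio {α : ℝ} (hα : 0 < α) : ∃ θ ∈ Set.Icc (0 : ℝ) Real.pi,
    spinorV θ 0 ≠ 0 ∧ spinorU θ 0 = α * spinorV θ 0 := by
  have h0 : 0 < Real.arctan α⁻¹ := Real.arctan_pos.mpr (by positivity)
  have h1 := Real.arctan_lt_pi_div_two α⁻¹
  refine ⟨2 * Real.arctan α⁻¹, ⟨by linarith, by linarith⟩, ?_⟩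
  have hs : 0 < Real.sin (Real.arctan α⁻¹) :=
    Real.sin_pos_of_pos_of_lt_pi h0 (by linarith [Real.pi_pos])
  have hc : 0 < Real.cos (Real.arctan α⁻¹) := Real.cos_arctan_pos _
  have ht := Real.tan_arctan α⁻¹
  rw [Real.tan_eq_sin_div_cos, div_eq_iff hc.ne'] at ht
  have h2 : 2 * Real.arctan α⁻¹ / 2 = Real.arctan α⁻¹ := by ring
  simp only [spinorU, spinorV, h2]
  constructor
  · simpa using Complex.ofReal_ne_zero.mpr hs.ne'
  · have : Real.cos (Real.arctan α⁻¹) = α * Real.sin (Real.arctan α⁻¹) := by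
      rw [ht]; field_simp
    rw [this]
    simp

/-- The monomials of degrees `m` and `m'` at the sites `k` and `r`. -/
def endMonomial (k r m m' i i' : ℕ) : Fock :=
  aDag k ^ i * bDag k ^ (m - i) * (aDag r ^ i' * bDag r ^ (m' - i'))

lemma spinor_pow_mul_spinor_pow (u v : ℂ) (k r m m' : ℕ) :
    spinor u v k ^ m * spinor u v r ^ m' =
      ∑ i ∈ Finset.range (m + 1), ∑ i' ∈ Finset.range (m' + 1),
        (u ^ (i + i') * v ^ (m - i + (m' - i')) * (m.choose i * m'.choose i' : ℕ)) •
          endMonomial k r m m' i i' := by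
  rw [spinor, spinor, add_pow, add_pow, Finset.sum_mul_sum]
  refine Finset.sum_congr rfl fun i _ => Finset.sum_congr rfl fun i' _ => ?_
  rw [← C_mul', endMonomial, mul_pow, mul_pow, mul_pow, mul_pow]
  simp only [map_mul, map_pow, map_natCast]
  push_cast
  ring

/-- A linear functional that vanishes on all the highest components
`bond^n (u a + v b)^(m-n) (u a' + v b')^(m'-n)` of the two end spins vanishes identically. -/
lemma functional_endMonomial_eq_zero (k r m m' : ℕ) (f : Fock →ₗ[ℂ] ℂ)
    (hf : ∀ n ≤ min m m', ∀ θ ∈ Set.Icc (0 : ℝ) Real.pi,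
      f (bond k r ^ n * (spinor (spinorU θ 0) (spinorV θ 0) k ^ (m - n) *
        spinor (spinorU θ 0) (spinorV θ 0) r ^ (m' - n))) = 0) {n : ℕ} (hn : n ≤ min m m') :
    ∀ i ≤ m - n, ∀ i' ≤ m' - n, f (bond k r ^ n * endMonomial k r (m - n) (m' - n) i i') = 0 := by
  have step : ∀ n ≤ min m m', (∀ i < m - n, ∀ i' < m' - n,
      f (bond k r ^ (n + 1) * endMonomial k r (m - (n + 1)) (m' - (n + 1)) i i') = 0) →
      ∀ i ≤ m - n, ∀ i' ≤ m' - n,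
        f (bond k r ^ n * endMonomial k r (m - n) (m' - n) i i') = 0 := by
    intro n hn hd i hi i' hi'
    have h := norm_le_of_antidiagonal (m := m - n) (m' := m' - n) (δ := 0) (η := 0)
      (e := fun i i' => f (bond k r ^ n * endMonomial k r (m - n) (m' - n) i i')) le_rfl
      ?_ ?_ hi hi'
    · simpa using h
    · intro i hi i' hi'
      -- Neighbours on an antidiagonal differ by one inserted bond, that is, by a term of the next
      -- lower spin.
      have e : bond k r ^ n * endMonomial k r (m - n) (m' - n) (i + 1) i' -
          bond k r ^ n * endMonomial k r (m - n) (m' - n) i (i' + 1) =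
          bond k r ^ (n + 1) * endMonomial k r (m - (n + 1)) (m' - (n + 1)) i i' := by
        rw [endMonomial, endMonomial, endMonomial, show m - n - i = m - (n + 1) - i + 1 by omega,
          show m' - n - i' = m' - (n + 1) - i' + 1 by omega,
          show m - n - (i + 1) = m - (n + 1) - i by omega,
          show m' - n - (i' + 1) = m' - (n + 1) - i' by omega, pow_succ _ n]
        simp only [bond]
        ring
      rw [← map_sub, e, hd i hi i' hi', norm_zero]
    · intro t
      have hz := antidiagonal_eq_zero (s := Finset.range (m - n + 1))
        (s' := Finset.range (m' - n + 1)) (S := Complex.ofReal '' Set.Ioi 0)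
        (F := fun i i' => ((m - n).choose i * (m' - n).choose i' : ℕ) *
          f (bond k r ^ n * endMonomial k r (m - n) (m' - n) i i'))
        ((Set.Ioi_infinite 0).image Complex.ofReal_injective.injOn) ?_ t
      · rw [hz, norm_zero]
      · rintro _ ⟨α, hα, rfl⟩
        obtain ⟨θ, hθ, hv, hu⟩ := exists_spinor_ratio hα
        have h0 := hf n hn θ hθ
        rw [spinor_pow_mul_spinor_pow, Finset.mul_sum, map_sum] at h0
        refine (mul_eq_zero.mp (Eq.trans ?_ h0)).resolve_left
          (pow_ne_zero (m - n + (m' - n)) hv)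
        rw [Finset.mul_sum]
        refine Finset.sum_congr rfl fun i hi => ?_
        rw [Finset.mul_sum, Finset.mul_sum, map_sum]
        refine Finset.sum_congr rfl fun i' hi' => ?_
        have hi : i ≤ m - n := by simpa [Nat.lt_succ_iff] using hi
        have hi' : i' ≤ m' - n := by simpa [Nat.lt_succ_iff] using hi'
        rw [mul_smul_comm, map_smul, smul_eq_mul, hu, mul_pow,
          show m - n + (m' - n) = (i + i') + (m - n - i + (m' - n - i')) by omega, pow_add]
        ring
  induction hn using Nat.decreasingInduction with
  | of_succ n hn ih =>
    refine step n (by omega) fun i hi i' hi' => ih i (by omega) i' (by omega)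
  | self =>
    -- At `n = min m m'` one of the two remaining degrees is 0, so there are no differences to
    -- control.
    exact step _ le_rfl fun i hi i' hi' => by omega

namespace ChainBlock

variable (C : ChainBlock)

lemma endMonomial_mul_blockVBS {i i' : ℕ} (hi : i ≤ C.leftBond) :
    endMonomial C.first C.last C.leftBond C.rightBond i i' * C.blockVBS =
      ((-1 : ℂ) ^ i) • blockPoly C.M C.first C.last C.leftBond C.rightBond (C.leftBond - i) i' := by
  rw [endMonomial, blockPoly, neg_pow (aDag C.first), Nat.sub_sub_self hi, ← C_mul']
  have h : C.blockVBS = chain C.M C.first C.last := rfl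
  have h1 : ((-1 : Fock) ^ i) * (-1) ^ i = 1 := by rw [← mul_pow]; simp
  have hC : (MvPolynomial.C ((-1 : ℂ) ^ i) : Fock) = (-1) ^ i := by simp
  rw [h, hC]
  linear_combination (-aDag C.first ^ i * bDag C.first ^ (C.leftBond - i) *
    (aDag C.last ^ i' * bDag C.last ^ (C.rightBond - i')) * chain C.M C.first C.last) * h1

lemma operatorA_mul_mem_span {n : ℕ} (hn : n ≤ min C.leftBond C.rightBond) (θ φ : ℝ) :
    C.operatorA n θ φ * C.blockVBS ∈ Submodule.span ℂ (Set.range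
      fun a : Fin (C.leftBond + 1) × Fin (C.rightBond + 1) =>
        blockPoly C.M C.first C.last C.leftBond C.rightBond a.1 a.2) := by
  have hn1 : n ≤ C.leftBond := hn.trans (min_le_left _ _)
  have hn2 : n ≤ C.rightBond := hn.trans (min_le_right _ _)
  set T := Submodule.span ℂ (Set.range
      fun a : Fin (C.leftBond + 1) × Fin (C.rightBond + 1) =>
        blockPoly C.M C.first C.last C.leftBond C.rightBond a.1 a.2) with hT
  have hmem : ∀ i ≤ C.leftBond, ∀ i' ≤ C.rightBond,
      endMonomial C.first C.last C.leftBond C.rightBond i i' * C.blockVBS ∈ T := by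
    intro i hi i' hi'
    rw [C.endMonomial_mul_blockVBS hi]
    exact T.smul_mem _ (Submodule.subset_span
      ⟨(⟨C.leftBond - i, by omega⟩, ⟨i', by omega⟩), rfl⟩)
  have e : C.operatorA n θ φ = bond C.first C.last ^ n *
      (spinor (spinorU θ φ) (spinorV θ φ) C.first ^ (C.leftBond - n) *
        spinor (spinorU θ φ) (spinorV θ φ) C.last ^ (C.rightBond - n)) := by
    rw [operatorA, spinor, spinor]; ring
  rw [e, spinor_pow_mul_spinor_pow, Finset.mul_sum, Finset.sum_mul]
  refine T.sum_mem fun i hi => ?_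
  rw [Finset.mul_sum, Finset.sum_mul]
  refine T.sum_mem fun i' hi' => ?_
  rw [mul_smul_comm, smul_mul_assoc]
  refine T.smul_mem _ ?_
  have hi : i ≤ C.leftBond - n := by simpa [Nat.lt_succ_iff] using hi
  have hi' : i' ≤ C.rightBond - n := by simpa [Nat.lt_succ_iff] using hi'
  have eb : bond C.first C.last ^ n = ∑ j ∈ Finset.range (n + 1),
      ((-1 : ℂ) ^ (n - j) * n.choose j) • (aDag C.first ^ j * bDag C.last ^ j *
        (bDag C.first ^ (n - j) * aDag C.last ^ (n - j))) := by
    rw [bond, sub_eq_add_neg, add_pow]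
    refine Finset.sum_congr rfl fun j _ => ?_
    rw [← C_mul', neg_pow, mul_pow, mul_pow]
    simp only [map_mul, map_pow, map_natCast, map_neg, map_one]
    ring
  rw [eb, Finset.sum_mul, Finset.sum_mul]
  refine T.sum_mem fun j hj => ?_
  have hj : j ≤ n := by simpa [Nat.lt_succ_iff] using hj
  rw [smul_mul_assoc, smul_mul_assoc]
  refine T.smul_mem _ ?_
  convert hmem (i + j) (by omega) (i' + (n - j)) (by omega) using 2
  rw [endMonomial, endMonomial, show C.leftBond - (i + j) = (C.leftBond - n - i) + (n - j) by omega,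
    show C.rightBond - (i' + (n - j)) = (C.rightBond - n - i') + j by omega]
  ring

lemma span_toSpin_blockPoly : (Submodule.span ℂ (Set.range
      fun a : Fin (C.leftBond + 1) × Fin (C.rightBond + 1) =>
        blockPoly C.M C.first C.last C.leftBond C.rightBond a.1 a.2)).map
          (toSpinLinear C.twoS C.block) = Submodule.span ℂ (Set.range C.blockVec) := by
  rw [Submodule.map_span, ← Set.range_comp]
  refine le_antisymm (Submodule.span_le.mpr ?_) (Submodule.span_le.mpr ?_)
  · rintro _ ⟨a, rfl⟩
    have h : (Real.sqrt (endWeight C.leftBond C.rightBond a) : ℂ) ≠ 0 := by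
      have := endWeight_pos C.leftBond C.rightBond a
      exact_mod_cast (Real.sqrt_pos.mpr (by exact_mod_cast this)).ne'
    have : toSpin C.twoS C.block (blockPoly C.M C.first C.last C.leftBond C.rightBond a.1 a.2) =
        (Real.sqrt (endWeight C.leftBond C.rightBond a) : ℂ) • C.blockVec a := by
      rw [blockVec, smul_smul]
      push_cast
      rw [mul_inv_cancel₀ h, one_smul]
    change toSpin C.twoS C.block _ ∈ _
    rw [this]
    exact Submodule.smul_mem _ _ (Submodule.subset_span ⟨a, rfl⟩)
  · rintro _ ⟨a, rfl⟩
    exact Submodule.smul_mem _ _ (Submodule.subset_span ⟨a, rfl⟩)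

lemma groundState_mem {n : ℕ} (hn : n ≤ min C.leftBond C.rightBond) (θ φ : ℝ) :
    C.groundState n θ φ ∈ Submodule.span ℂ (Set.range C.blockVec) := by
  rw [← C.span_toSpin_blockPoly]
  exact Submodule.mem_map_of_mem (C.operatorA_mul_mem_span hn θ φ)

/-- The polynomial is a product of nonzero factors in a domain (`bond k k` would be 0), and
independence of the block vectors prevents `toSpin` from killing it. -/
lemma groundState_ne_zero (h : C.first ≠ C.last) (hli : LinearIndependent ℂ C.blockVec)
    {n : ℕ} (hn : n ≤ min C.leftBond C.rightBond) (θ φ : ℝ) : C.groundState n θ φ ≠ 0 := by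
  intro h0
  have hP : C.operatorA n θ φ * C.blockVBS ≠ 0 := by
    have hs := spinorUV_ne_zero θ φ
    exact mul_ne_zero (mul_ne_zero (mul_ne_zero (pow_ne_zero _ (spinor_ne_zero hs _))
      (pow_ne_zero _ (bond_ne_zero h))) (pow_ne_zero _ (spinor_ne_zero hs _)))
      (chain_ne_zero _ _ _)
  obtain ⟨c, hc⟩ := (Submodule.mem_span_range_iff_exists_fun ℂ).mp
    (C.operatorA_mul_mem_span hn θ φ)
  apply hP
  rw [← hc]
  have h1 : ∑ a, (c a * (Real.sqrt (endWeight C.leftBond C.rightBond a) : ℂ)) • C.blockVec a = 0 := by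
    rw [← h0, groundState, ← hc, toSpin_sum]
    refine Finset.sum_congr rfl fun a _ => ?_
    have h : (Real.sqrt (endWeight C.leftBond C.rightBond a) : ℂ) ≠ 0 := by
      have := endWeight_pos C.leftBond C.rightBond a
      exact_mod_cast (Real.sqrt_pos.mpr (by exact_mod_cast this)).ne'
    rw [toSpin_smul, blockVec, smul_smul]
    push_cast
    rw [mul_assoc, mul_inv_cancel₀ h, mul_one]
  have h2 := Fintype.linearIndependent_iff.mp hli _ h1
  refine Finset.sum_eq_zero fun a _ => ?_
  have h : (Real.sqrt (endWeight C.leftBond C.rightBond a) : ℂ) ≠ 0 := by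
    have := endWeight_pos C.leftBond C.rightBond a
    exact_mod_cast (Real.sqrt_pos.mpr (by exact_mod_cast this)).ne'
  rw [(mul_eq_zero.mp (h2 a)).resolve_right h, zero_smul]

lemma groundSpace_eq : C.groundSpace = Submodule.span ℂ (Set.range C.blockVec) := by
  refine le_antisymm (Submodule.span_le.mpr ?_) ?_
  · rintro _ ⟨n, hn, θ, _, φ, _, rfl⟩
    exact C.groundState_mem hn θ φ
  · rw [← C.span_toSpin_blockPoly, Submodule.map_span, ← Set.range_comp]
    refine Submodule.span_le.mpr ?_
    rintro _ ⟨⟨p, q⟩, rfl⟩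
    by_contra hcon
    -- The nontrivial inclusion goes by duality: a functional that kills all ground states kills
    -- every `endMonomial`, hence every block state.
    obtain ⟨ℓ, hℓ, hker⟩ := Submodule.exists_le_ker_of_notMem (p := C.groundSpace) hcon
    apply hℓ
    have hp : (p : ℕ) ≤ C.leftBond := Nat.lt_succ_iff.mp p.2
    have hq : (q : ℕ) ≤ C.rightBond := Nat.lt_succ_iff.mp q.2
    have := functional_endMonomial_eq_zero C.first C.last C.leftBond C.rightBond
      (ℓ ∘ₗ toSpinLinear C.twoS C.block ∘ₗ LinearMap.mulRight ℂ C.blockVBS) ?_ (Nat.zero_le _)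
      (C.leftBond - p) (by omega) q (by omega)
    · simp only [pow_zero, one_mul, Nat.sub_zero, LinearMap.comp_apply, LinearMap.mulRight_apply] at this
      rw [C.endMonomial_mul_blockVBS (by omega), map_smul, map_smul, Nat.sub_sub_self hp,
        smul_eq_mul, mul_eq_zero] at this
      exact this.resolve_left (pow_ne_zero _ (by norm_num))
    · intro n hn θ hθ
      have hg : C.groundState n θ 0 ∈ C.groundSpace := Submodule.subset_span
        ⟨n, hn, θ, hθ, 0, ⟨le_rfl, by positivity⟩, rfl⟩
      have := hker hg
      rw [LinearMap.mem_ker] at this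
      rw [← this]
      simp only [LinearMap.comp_apply, LinearMap.mulRight_apply]
      refine congrArg ℓ (congrArg (toSpin C.twoS C.block) ?_)
      rw [operatorA, spinor, spinor]
      ring

end ChainBlock

end

end AKLT

namespace AKLT

noncomputable section

/-! ### Mixtures of almost orthogonal states -/

section Mixture

variable {ι n : Type} [Fintype ι] [Fintype n]

lemma sum_inner_self (w : ι → EuclideanSpace ℂ n) :
    ∑ a, inner ℂ (w a) (w a) = ((∑ a, ‖w a‖ ^ 2 : ℝ) : ℂ) := by
  push_cast
  exact Finset.sum_congr rfl fun a _ => inner_self_eq_norm_sq_to_K _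

lemma mixture_isHermitian (w : ι → EuclideanSpace ℂ n) : (mixture w).IsHermitian := by
  ext x y
  rw [Matrix.conjTranspose_apply, mixture, mixture, sum_inner_self, star_div₀, star_sum]
  congr 1
  · refine Finset.sum_congr rfl fun a _ => ?_
    rw [star_mul', star_star, mul_comm]
  · exact Complex.conj_ofReal _

lemma trace_mixture {w : ι → EuclideanSpace ℂ n} (hw : 0 < ∑ a, ‖w a‖ ^ 2) :
    (mixture w).trace = 1 := by
  have h : ∑ a, inner ℂ (w a) (w a) ≠ (0 : ℂ) := by
    rw [sum_inner_self]; exact_mod_cast hw.ne'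
  rw [Matrix.trace]
  simp only [Matrix.diag, mixture]
  rw [← Finset.sum_div, Finset.sum_comm, div_eq_one_iff_eq h]
  refine Finset.sum_congr rfl fun a _ => ?_
  rw [PiLp.inner_apply]
  rfl

lemma mixture_apply [DecidableEq n] (w : ι → EuclideanSpace ℂ n) (ψ : EuclideanSpace ℂ n) :
    Matrix.toEuclideanCLM (𝕜 := ℂ) (mixture w) ψ =
      ∑ a, (inner ℂ (w a) ψ / ((∑ a, ‖w a‖ ^ 2 : ℝ) : ℂ)) • w a := by
  ext x
  rw [Matrix.ofLp_toEuclideanCLM, Matrix.mulVec, dotProduct, WithLp.ofLp_sum, Finset.sum_apply]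
  simp only [mixture, sum_inner_self]
  generalize ((∑ a, ‖w a‖ ^ 2 : ℝ) : ℂ) = τ
  simp only [PiLp.smul_apply, smul_eq_mul, PiLp.inner_apply, RCLike.inner_apply, Finset.sum_div,
    Finset.sum_mul]
  rw [Finset.sum_comm]
  refine Finset.sum_congr rfl fun a _ => Finset.sum_congr rfl fun y _ => ?_
  rw [← starRingEnd_apply]
  ring

lemma trace_cfc [DecidableEq n] {A : Matrix n n ℂ} (hA : A.IsHermitian) (f : ℝ → ℝ) :
    (cfc f A).trace.re = ∑ i, f (hA.eigenvalues i) := by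
  rw [hA.cfc_eq, Matrix.IsHermitian.cfc, Unitary.conjStarAlgAut_apply, Matrix.trace_mul_cycle,
    Unitary.coe_star_mul_self, one_mul, Matrix.trace_diagonal]
  simp

lemma mixture_apply_mem [DecidableEq n] (w : ι → EuclideanSpace ℂ n) (ψ : EuclideanSpace ℂ n) :
    Matrix.toEuclideanCLM (𝕜 := ℂ) (mixture w) ψ ∈ Submodule.span ℂ (Set.range w) := by
  rw [mixture_apply]
  exact Submodule.sum_mem _ fun a _ => Submodule.smul_mem _ _ (Submodule.subset_span ⟨a, rfl⟩)

lemma mixture_apply_eq_zero [DecidableEq n] {w : ι → EuclideanSpace ℂ n} {ψ : EuclideanSpace ℂ n}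
    (hψ : ψ ∈ (Submodule.span ℂ (Set.range w))ᗮ) :
    Matrix.toEuclideanCLM (𝕜 := ℂ) (mixture w) ψ = 0 := by
  rw [mixture_apply]
  refine Finset.sum_eq_zero fun a _ => ?_
  rw [(Submodule.mem_orthogonal _ _).mp hψ _ (Submodule.subset_span ⟨a, rfl⟩), zero_div, zero_smul]

lemma sq_sum_norm_le (ξ : ι → ℂ) : (∑ a, ‖ξ a‖) ^ 2 ≤ Fintype.card ι * ∑ a, ‖ξ a‖ ^ 2 := by
  simpa using sq_sum_le_card_mul_sum_sq (s := Finset.univ) (f := fun a => ‖ξ a‖)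

variable {w : ι → EuclideanSpace ℂ n} {τ c δ : ℝ}

variable [DecidableEq ι]

/-- The Gram matrix of `w` is, up to the factor `τ`, within `δ` of `c` times the identity. -/
def AlmostOrthogonal (w : ι → EuclideanSpace ℂ n) (τ c δ : ℝ) : Prop :=
  ∀ a b, ‖inner ℂ (w a) (w b) / (τ : ℂ) - if a = b then (c : ℂ) else 0‖ ≤ δ

/-- The left side is the quadratic form of the Gram error; bound its entries by `δ` and apply
Cauchy-Schwarz to the sum of the `‖ξ a‖`. -/
lemma AlmostOrthogonal.abs_norm_sq_sub_le (hG : AlmostOrthogonal w τ c δ)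
    (ξ : ι → ℂ) : |‖∑ a, ξ a • w a‖ ^ 2 / τ - c * ∑ a, ‖ξ a‖ ^ 2| ≤
      δ * (Fintype.card ι * ∑ a, ‖ξ a‖ ^ 2) := by
  have e : ((‖∑ a, ξ a • w a‖ ^ 2 / τ - c * ∑ a, ‖ξ a‖ ^ 2 : ℝ) : ℂ) =
      ∑ a, ∑ b, (starRingEnd ℂ) (ξ a) * ξ b *
        (inner ℂ (w a) (w b) / (τ : ℂ) - if a = b then (c : ℂ) else 0) := by
    have h1 : ((‖∑ a, ξ a • w a‖ : ℂ)) ^ 2 = ∑ a, ∑ b, (starRingEnd ℂ) (ξ a) * ξ b *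
        inner ℂ (w a) (w b) := by
      have := inner_self_eq_norm_sq_to_K (𝕜 := ℂ) (∑ a, ξ a • w a)
      rw [sum_inner] at this
      refine this.symm.trans (Finset.sum_congr rfl fun a _ => ?_)
      rw [inner_sum]
      refine Finset.sum_congr rfl fun b _ => ?_
      rw [inner_smul_left, inner_smul_right]
      ring
    push_cast
    rw [h1, Finset.sum_div, Finset.mul_sum, ← Finset.sum_sub_distrib]
    refine Finset.sum_congr rfl fun a _ => ?_
    simp only [mul_sub, Finset.sum_sub_distrib, Finset.sum_div]
    congr 1
    · exact Finset.sum_congr rfl fun b _ => by ring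
    · rw [Finset.sum_eq_single a]
      · rw [if_pos rfl, Complex.conj_mul']; ring
      · intro b _ hb; rw [if_neg hb.symm, mul_zero]
      · simp
  have hδ : ∀ a b, ‖(starRingEnd ℂ) (ξ a) * ξ b *
        (inner ℂ (w a) (w b) / (τ : ℂ) - if a = b then (c : ℂ) else 0)‖ ≤ ‖ξ a‖ * ‖ξ b‖ * δ := by
    intro a b
    rw [norm_mul, norm_mul, RCLike.norm_conj]
    exact mul_le_mul_of_nonneg_left (hG a b) (by positivity)
  rw [← Real.norm_eq_abs, ← Complex.norm_real, e]
  have h2 : ‖∑ a, ∑ b, (starRingEnd ℂ) (ξ a) * ξ b *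
        (inner ℂ (w a) (w b) / (τ : ℂ) - if a = b then (c : ℂ) else 0)‖ ≤
      ∑ a, ∑ b, ‖ξ a‖ * ‖ξ b‖ * δ :=
    norm_sum_le_of_le _ fun a _ => norm_sum_le_of_le _ fun b _ => hδ a b
  refine h2.trans ?_
  have h3 : ∑ a, ∑ b, ‖ξ a‖ * ‖ξ b‖ * δ = (∑ a, ‖ξ a‖) ^ 2 * δ := by
    rw [sq, Finset.sum_mul_sum, Finset.sum_mul]
    exact Finset.sum_congr rfl fun a _ => by rw [Finset.sum_mul]
  rw [h3]
  rcases isEmpty_or_nonempty ι with hι | ⟨⟨a⟩⟩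
  · simp
  · have : 0 ≤ δ := (norm_nonneg _).trans (hG a a)
    rw [mul_comm]
    exact mul_le_mul_of_nonneg_left (sq_sum_norm_le ξ) this

lemma AlmostOrthogonal.le_norm_sq (hG : AlmostOrthogonal w τ c δ) (hτ : 0 < τ)
    (hδ : δ * Fintype.card ι ≤ c / 2) (ξ : ι → ℂ) :
    τ * (c / 2) * ∑ a, ‖ξ a‖ ^ 2 ≤ ‖∑ a, ξ a • w a‖ ^ 2 := by
  have h := (abs_le.mp (hG.abs_norm_sq_sub_le ξ)).1
  have hS : 0 ≤ ∑ a, ‖ξ a‖ ^ 2 := Finset.sum_nonneg fun _ _ => by positivity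
  have h1 : c / 2 * ∑ a, ‖ξ a‖ ^ 2 ≤ ‖∑ a, ξ a • w a‖ ^ 2 / τ := by nlinarith
  rw [le_div_iff₀ hτ] at h1
  linarith

lemma AlmostOrthogonal.norm_sq_le (hG : AlmostOrthogonal w τ c δ) (hτ : 0 < τ)
    (hδ : δ * Fintype.card ι ≤ c / 2) (ξ : ι → ℂ) :
    ‖∑ a, ξ a • w a‖ ^ 2 ≤ τ * (2 * c) * ∑ a, ‖ξ a‖ ^ 2 := by
  have h := (abs_le.mp (hG.abs_norm_sq_sub_le ξ)).2
  have hS : 0 ≤ ∑ a, ‖ξ a‖ ^ 2 := Finset.sum_nonneg fun _ _ => by positivity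
  rcases isEmpty_or_nonempty ι with hι | ⟨⟨a⟩⟩
  · simp
  have hδ0 : 0 ≤ δ := (norm_nonneg _).trans (hG a a)
  have hc : 0 ≤ c := by
    have : 0 ≤ δ * Fintype.card ι := by positivity
    linarith
  have h1 : ‖∑ a, ξ a • w a‖ ^ 2 / τ ≤ 2 * c * ∑ a, ‖ξ a‖ ^ 2 := by nlinarith
  rw [div_le_iff₀ hτ] at h1
  linarith

lemma AlmostOrthogonal.linearIndependent (hG : AlmostOrthogonal w τ c δ) (hτ : 0 < τ) (hc : 0 < c)
    (hδ : δ * Fintype.card ι ≤ c / 2) : LinearIndependent ℂ w := by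
  rw [Fintype.linearIndependent_iff]
  intro ξ h a
  have h1 := hG.le_norm_sq hτ hδ ξ
  rw [h, norm_zero] at h1
  have h2 : ‖ξ a‖ ^ 2 ≤ ∑ a, ‖ξ a‖ ^ 2 :=
    Finset.single_le_sum (f := fun a => ‖ξ a‖ ^ 2) (fun _ _ => by positivity) (Finset.mem_univ a)
  have h3 : 0 < τ * (c / 2) := by positivity
  have h4 : ‖ξ a‖ ^ 2 ≤ 0 := by nlinarith
  have h5 : ‖ξ a‖ = 0 := by nlinarith [norm_nonneg (ξ a)]
  exact norm_eq_zero.mp h5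

/-- Normalizing an almost orthonormal family. -/
lemma AlmostOrthogonal.normalize [Nonempty ι] {σ ε : ℝ} (hσ : 0 < σ)
    (hG : AlmostOrthogonal w σ 1 ε) (hε : ε ≤ 1 / 2) :
    0 < ∑ a, ‖w a‖ ^ 2 ∧
      AlmostOrthogonal w (∑ a, ‖w a‖ ^ 2) (1 / Fintype.card ι) (4 * ε) := by
  set τ := ∑ a, ‖w a‖ ^ 2 with hτ
  set D : ℝ := (Fintype.card ι : ℝ) with hD
  have hD1 : 1 ≤ D := by rw [hD]; exact_mod_cast Fintype.card_pos
  have h1 : |τ / σ - D| ≤ D * ε := by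
    have e : ((τ / σ - D : ℝ) : ℂ) = ∑ a, (inner ℂ (w a) (w a) / (σ : ℂ) - 1) := by
      rw [Finset.sum_sub_distrib, ← Finset.sum_div, sum_inner_self, hτ, hD]
      simp
    rw [← Real.norm_eq_abs, ← Complex.norm_real, e, hD, ← nsmul_eq_mul,
      ← Finset.card_univ, ← Finset.sum_const]
    refine norm_sum_le_of_le _ fun a _ => ?_
    simpa using hG a a
  have hε0 : 0 ≤ ε := by
    obtain ⟨a⟩ := ‹Nonempty ι›
    exact (norm_nonneg _).trans (hG a a)
  obtain ⟨h2, h3⟩ := abs_le.mp h1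
  -- Since `D ≥ 1`, dividing by `τ / σ` costs at most a factor 2; with two errors of size `ε` this
  -- gives `4 * ε`.
  have h4 : D / 2 ≤ τ / σ := by nlinarith
  have h5 : 0 < τ / σ := by linarith
  have hτ0 : 0 < τ := by
    have := mul_pos h5 hσ
    rwa [div_mul_cancel₀ _ hσ.ne'] at this
  refine ⟨hτ0, fun a b => ?_⟩
  have hτC : (τ : ℂ) ≠ 0 := by exact_mod_cast hτ0.ne'
  have hσC : (σ : ℂ) ≠ 0 := by exact_mod_cast hσ.ne'
  have hDC : (D : ℂ) ≠ 0 := by exact_mod_cast (by linarith : D ≠ 0)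
  have e : inner ℂ (w a) (w b) / (τ : ℂ) - (if a = b then ((1 / D : ℝ) : ℂ) else 0) =
      ((inner ℂ (w a) (w b) / (σ : ℂ) - if a = b then ((1 : ℝ) : ℂ) else 0) -
        (if a = b then 1 else 0) * ((τ / σ - D : ℝ) : ℂ) / D) / ((τ / σ : ℝ) : ℂ) := by
    push_cast
    split_ifs <;> field_simp <;> ring
  rw [e, norm_div, Complex.norm_real, Real.norm_of_nonneg h5.le, div_le_iff₀ h5]
  refine (norm_sub_le _ _).trans ?_
  have h6 : ‖(if a = b then (1 : ℂ) else 0) * ((τ / σ - D : ℝ) : ℂ) / D‖ ≤ ε := by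
    rw [norm_div, norm_mul, Complex.norm_real, Complex.norm_real, Real.norm_eq_abs,
      Real.norm_of_nonneg (by linarith), div_le_iff₀ (by linarith)]
    have : ‖(if a = b then (1 : ℂ) else 0)‖ ≤ 1 := by split_ifs <;> simp
    calc _ ≤ 1 * |τ / σ - D| := mul_le_mul_of_nonneg_right this (abs_nonneg _)
      _ ≤ _ := by linarith
  have h7 := hG a b
  nlinarith

variable [DecidableEq n]

/-- The mixture acts on the span of the states `w a` almost as the scalar `c`. -/
lemma AlmostOrthogonal.norm_apply_sub_le (hG : AlmostOrthogonal w (∑ a, ‖w a‖ ^ 2) c δ)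
    (hτ : 0 < ∑ a, ‖w a‖ ^ 2) (hc : 0 < c) (hδ0 : 0 ≤ δ) (hδ : δ * Fintype.card ι ≤ c / 2)
    {ψ : EuclideanSpace ℂ n} (hψ : ψ ∈ Submodule.span ℂ (Set.range w)) :
    ‖Matrix.toEuclideanCLM (𝕜 := ℂ) (mixture w) ψ - (c : ℂ) • ψ‖ ≤
      2 * Fintype.card ι * δ * ‖ψ‖ := by
  obtain ⟨ξ, rfl⟩ := (Submodule.mem_span_range_iff_exists_fun ℂ).mp hψ
  set τ := ∑ a, ‖w a‖ ^ 2 with hτdef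
  set D : ℝ := (Fintype.card ι : ℝ) with hD
  set S := ∑ a, ‖ξ a‖ ^ 2 with hS
  -- On coefficient vectors the mixture acts as the normalized Gram matrix, so `η` is the Gram error
  -- applied to `ξ`.
  set η : ι → ℂ := fun a => ∑ b, (inner ℂ (w a) (w b) / (τ : ℂ) - if a = b then (c : ℂ) else 0) * ξ b
    with hη
  have e : Matrix.toEuclideanCLM (𝕜 := ℂ) (mixture w) (∑ a, ξ a • w a) - (c : ℂ) • ∑ a, ξ a • w a =
      ∑ a, η a • w a := by
    rw [mixture_apply, Finset.smul_sum, ← Finset.sum_sub_distrib]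
    refine Finset.sum_congr rfl fun a _ => ?_
    rw [smul_smul, ← sub_smul, inner_sum]
    congr 1
    simp only [hη, sub_mul, Finset.sum_sub_distrib, Finset.sum_div]
    congr 1
    · refine Finset.sum_congr rfl fun b _ => ?_
      rw [inner_smul_right]; ring
    · simp
  have hηa : ∀ a, ‖η a‖ ^ 2 ≤ δ ^ 2 * (D * S) := by
    intro a
    have h1 : ‖η a‖ ≤ δ * ∑ b, ‖ξ b‖ := by
      rw [Finset.mul_sum]
      refine norm_sum_le_of_le _ fun b _ => ?_
      rw [norm_mul]
      exact mul_le_mul_of_nonneg_right (hG a b) (norm_nonneg _)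
    calc ‖η a‖ ^ 2 ≤ (δ * ∑ b, ‖ξ b‖) ^ 2 := by gcongr
      _ = δ ^ 2 * (∑ b, ‖ξ b‖) ^ 2 := by ring
      _ ≤ _ := mul_le_mul_of_nonneg_left (sq_sum_norm_le ξ) (by positivity)
  have hηS : ∑ a, ‖η a‖ ^ 2 ≤ D ^ 2 * δ ^ 2 * S := by
    refine (Finset.sum_le_sum fun a _ => hηa a).trans (le_of_eq ?_)
    rw [Finset.sum_const, Finset.card_univ, nsmul_eq_mul]
    ring
  have h1 := hG.norm_sq_le hτ hδ η
  have h2 := hG.le_norm_sq hτ hδ ξ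
  rw [e]
  have hD0 : 0 ≤ D := by positivity
  have hX := norm_nonneg (∑ a, η a • w a)
  generalize ‖∑ a, η a • w a‖ = X at h1 hX ⊢
  have hY := norm_nonneg (∑ a, ξ a • w a)
  generalize ‖∑ a, ξ a • w a‖ = Y at h2 hY ⊢
  generalize ∑ a, ‖η a‖ ^ 2 = E at h1 hηS
  refine (pow_le_pow_iff_left₀ (by positivity) (by positivity) two_ne_zero).mp ?_
  calc X ^ 2 ≤ τ * (2 * c) * E := h1
    _ ≤ τ * (2 * c) * (D ^ 2 * δ ^ 2 * S) := mul_le_mul_of_nonneg_left hηS (by positivity)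
    _ = 4 * D ^ 2 * δ ^ 2 * (τ * (c / 2) * S) := by ring
    _ ≤ 4 * D ^ 2 * δ ^ 2 * Y ^ 2 := mul_le_mul_of_nonneg_left h2 (by positivity)
    _ = _ := by ring

lemma AlmostOrthogonal.norm_sub_starProjection_le
    (hG : AlmostOrthogonal w (∑ a, ‖w a‖ ^ 2) c δ)
    (hτ : 0 < ∑ a, ‖w a‖ ^ 2) (hc : 0 < c) (hδ0 : 0 ≤ δ) (hδ : δ * Fintype.card ι ≤ c / 2) :
    ‖Matrix.toEuclideanCLM (𝕜 := ℂ) (mixture w) -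
        (c : ℂ) • (Submodule.span ℂ (Set.range w)).starProjection‖ ≤ 2 * Fintype.card ι * δ := by
  refine ContinuousLinearMap.opNorm_le_bound _ (by positivity) fun ψ => ?_
  set U := Submodule.span ℂ (Set.range w) with hU
  have h1 : Matrix.toEuclideanCLM (𝕜 := ℂ) (mixture w) ψ =
      Matrix.toEuclideanCLM (𝕜 := ℂ) (mixture w) (U.starProjection ψ) := by
    rw [← sub_eq_zero, ← map_sub]
    exact mixture_apply_eq_zero (Submodule.sub_starProjection_mem_orthogonal ψ)
  rw [sub_apply, smul_apply, h1]
  refine (hG.norm_apply_sub_le hτ hc hδ0 hδ (Submodule.starProjection_apply_mem U ψ)).trans ?_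
  exact mul_le_mul_of_nonneg_left (Submodule.norm_starProjection_apply_le U ψ) (by positivity)

/-- An eigenvector with nonzero eigenvalue lies in the range, hence in the span, where the mixture
is almost the scalar `c`. -/
lemma AlmostOrthogonal.abs_eigenvalue_sub_le (hG : AlmostOrthogonal w (∑ a, ‖w a‖ ^ 2) c δ)
    (hτ : 0 < ∑ a, ‖w a‖ ^ 2) (hc : 0 < c) (hδ0 : 0 ≤ δ) (hδ : δ * Fintype.card ι ≤ c / 2)
    {i : n} (hi : (mixture_isHermitian w).eigenvalues i ≠ 0) :
    |(mixture_isHermitian w).eigenvalues i - c| ≤ 2 * Fintype.card ι * δ := by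
  set hA := mixture_isHermitian w
  set v := hA.eigenvectorBasis i with hv
  have hv1 : ‖v‖ = 1 := hA.eigenvectorBasis.orthonormal.1 i
  have hAv : Matrix.toEuclideanCLM (𝕜 := ℂ) (mixture w) v = (hA.eigenvalues i : ℂ) • v := by
    ext x
    rw [Matrix.ofLp_toEuclideanCLM, hv, hA.mulVec_eigenvectorBasis]
    simp
  have hmem : v ∈ Submodule.span ℂ (Set.range w) := by
    have h := mixture_apply_mem w v
    rw [hAv] at h
    exact (Submodule.smul_mem_iff _ (by exact_mod_cast hi)).mp h
  have h := hG.norm_apply_sub_le hτ hc hδ0 hδ hmem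
  rwa [hAv, ← sub_smul, norm_smul, hv1, mul_one, mul_one, ← Complex.ofReal_sub, Complex.norm_real,
    Real.norm_eq_abs] at h

/-- The nonzero eigenvalues sum to 1 and each is close to `1 / card ι`, so their number is an
integer at distance less than 1 from `card ι`. -/
lemma AlmostOrthogonal.card_eigenvalues_ne_zero [Nonempty ι]
    (hG : AlmostOrthogonal w (∑ a, ‖w a‖ ^ 2) c δ)
    (hτ : 0 < ∑ a, ‖w a‖ ^ 2) (hc : c * Fintype.card ι = 1) (hδ0 : 0 ≤ δ)
    (hδ : 8 * (Fintype.card ι : ℝ) ^ 3 * δ < 1) :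
    (Finset.univ.filter fun i => (mixture_isHermitian w).eigenvalues i ≠ 0).card =
      Fintype.card ι := by
  set hA := mixture_isHermitian w
  set D : ℝ := (Fintype.card ι : ℝ) with hD
  have hD1 : 1 ≤ D := by rw [hD]; exact_mod_cast Fintype.card_pos
  have hc0 : 0 < c := by
    by_contra! h
    nlinarith
  set s := Finset.univ.filter fun i => hA.eigenvalues i ≠ 0 with hs
  have hD3 : D ^ 2 * δ ≤ D ^ 3 * δ := by
    have : D ^ 2 ≤ D ^ 3 := pow_le_pow_right₀ hD1 (by norm_num)
    exact mul_le_mul_of_nonneg_right this hδ0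
  have hδ' : δ * D ≤ c / 2 := by
    have : δ * D * D ≤ c / 2 * D := by nlinarith
    exact le_of_mul_le_mul_right this (by linarith)
  have htr : ∑ i, hA.eigenvalues i = 1 := by
    have h := hA.trace_eq_sum_eigenvalues
    rw [trace_mixture hτ] at h
    simpa using (congrArg Complex.re h).symm
  have hsum : ∑ i ∈ s, hA.eigenvalues i = 1 := by
    rw [← htr, hs, Finset.sum_filter_ne_zero]
  have habs : |1 - (s.card : ℝ) * c| ≤ s.card * (2 * D * δ) := by
    have : 1 - (s.card : ℝ) * c = ∑ i ∈ s, (hA.eigenvalues i - c) := by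
      rw [Finset.sum_sub_distrib, hsum, Finset.sum_const, nsmul_eq_mul]
    rw [this]
    refine (Finset.abs_sum_le_sum_abs _ _).trans ?_
    rw [← nsmul_eq_mul, ← Finset.sum_const]
    refine Finset.sum_le_sum fun i hi => ?_
    exact hG.abs_eigenvalue_sub_le hτ hc0 hδ0 hδ' (Finset.mem_filter.mp hi).2
  have hk0 : (0 : ℝ) ≤ s.card := by positivity
  generalize hk : (s.card : ℝ) = k at habs hk0
  have h1 : |D - k| ≤ k * (2 * (D ^ 2 * δ)) := by
    have : D - k = (1 - k * c) * D := by linear_combination k * hc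
    rw [this, abs_mul, abs_of_pos (by linarith : 0 < D)]
    nlinarith
  obtain ⟨h2, h3⟩ := abs_le.mp h1
  have hk2 : k ≤ 2 * D := by nlinarith
  have h4 : k * (2 * (D ^ 2 * δ)) < 1 := by
    have : k * (2 * (D ^ 2 * δ)) ≤ 2 * D * (2 * (D ^ 2 * δ)) :=
      mul_le_mul_of_nonneg_right hk2 (by positivity)
    nlinarith
  have h5 : |D - k| < 1 := lt_of_le_of_lt h1 h4
  rw [← hk, hD] at h5
  have h6 : |(Fintype.card ι : ℤ) - s.card| < 1 := by exact_mod_cast h5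
  rw [Int.abs_lt_one_iff] at h6
  omega

lemma AlmostOrthogonal.abs_trace_cfc_sub_le [Nonempty ι]
    (hG : AlmostOrthogonal w (∑ a, ‖w a‖ ^ 2) c δ)
    (hτ : 0 < ∑ a, ‖w a‖ ^ 2) (hc : c * Fintype.card ι = 1) (hδ0 : 0 ≤ δ)
    (hδ : 8 * (Fintype.card ι : ℝ) ^ 3 * δ < 1) {f : ℝ → ℝ} (hf0 : f 0 = 0) {ε : ℝ}
    (hf : ∀ x, |x - c| ≤ 2 * Fintype.card ι * δ → |f x - f c| ≤ ε) :
    |(cfc f (mixture w)).trace.re - Fintype.card ι * f c| ≤ Fintype.card ι * ε := by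
  have hcard := hG.card_eigenvalues_ne_zero hτ hc hδ0 hδ
  rw [trace_cfc (mixture_isHermitian w)]
  set hA := mixture_isHermitian w
  set D : ℝ := (Fintype.card ι : ℝ) with hD
  have hD1 : 1 ≤ D := by rw [hD]; exact_mod_cast Fintype.card_pos
  have hc0 : 0 < c := by
    by_contra! h
    nlinarith
  have hδ' : δ * D ≤ c / 2 := by
    have hD3 : D ^ 2 * δ ≤ D ^ 3 * δ := by
      have : D ^ 2 ≤ D ^ 3 := pow_le_pow_right₀ hD1 (by norm_num)
      exact mul_le_mul_of_nonneg_right this hδ0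
    have : δ * D * D ≤ c / 2 * D := by nlinarith
    exact le_of_mul_le_mul_right this (by linarith)
  set s := Finset.univ.filter fun i => hA.eigenvalues i ≠ 0 with hs
  have h1 : ∑ i, f (hA.eigenvalues i) = ∑ i ∈ s, f (hA.eigenvalues i) := by
    refine (Finset.sum_subset (Finset.subset_univ _) fun i _ hi => ?_).symm
    have : hA.eigenvalues i = 0 := by simpa [hs] using hi
    rw [this, hf0]
  have h2 : D * f c = ∑ i ∈ s, f c := by
    rw [Finset.sum_const, hcard, nsmul_eq_mul]
  have h3 : D * ε = ∑ i ∈ s, ε := by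
    rw [Finset.sum_const, hcard, nsmul_eq_mul]
  rw [h1, h2, h3, ← Finset.sum_sub_distrib]
  refine (Finset.abs_sum_le_sum_abs _ _).trans (Finset.sum_le_sum fun i hi => hf _ ?_)
  exact hG.abs_eigenvalue_sub_le hτ hc0 hδ0 hδ' (Finset.mem_filter.mp hi).2

end Mixture

end

end AKLT

namespace AKLT

open Filter Topology

noncomputable section

/-! ### The large block limit -/

lemma ChainBlock.exists_almostOrthogonal_blockVec (Sm Sp : ℕ) : ∃ K : ℝ, 0 ≤ K ∧ ∀ C : ChainBlock,
    C.leftBond = Sm → C.rightBond = Sp →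
    AlmostOrthogonal C.blockVec (overlapScale C.M C.first C.last C.leftBond) 1
      (K * (1 + ∑ j ∈ Finset.Ico C.first C.last, (1 : ℝ) / C.M j)⁻¹) := by
  obtain ⟨K, hK0, hK⟩ := exists_bargmann_blockPoly_bound Sp Sm
  refine ⟨K, hK0, ?_⟩
  rintro C rfl rfl a b
  have h := hK C.M C.first C.last C.first_le_last rfl a.1 (Nat.lt_succ_iff.mp a.1.2) b.1
    (Nat.lt_succ_iff.mp b.1.2) a.2 (Nat.lt_succ_iff.mp a.2.2) b.2 (Nat.lt_succ_iff.mp b.2.2)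
  have hpos : ∀ a, 0 < Real.sqrt (endWeight C.leftBond C.rightBond a) := fun a =>
    Real.sqrt_pos.mpr (by exact_mod_cast endWeight_pos C.leftBond C.rightBond a)
  have hone : ∀ a, 1 ≤ Real.sqrt (endWeight C.leftBond C.rightBond a) := fun a =>
    Real.one_le_sqrt.mpr (by exact_mod_cast endWeight_pos C.leftBond C.rightBond a)
  have hab : ((a.1 : ℕ) = b.1 ∧ (a.2 : ℕ) = b.2) ↔ a = b := by
    rw [Prod.ext_iff, Fin.ext_iff, Fin.ext_iff]
  simp only [hab] at h
  -- Normalizing turns the diagonal limit into 1, and does not enlarge the error because every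
  -- `endWeight` is at least 1.
  set x : ℝ := (Real.sqrt (endWeight C.leftBond C.rightBond a))⁻¹ *
        (Real.sqrt (endWeight C.leftBond C.rightBond b))⁻¹ with hx
  have hx0 : 0 ≤ x := by positivity
  have hx1 : x ≤ 1 := mul_le_one₀ (inv_le_one_of_one_le₀ (hone a)) (by positivity)
    (inv_le_one_of_one_le₀ (hone b))
  have e : inner ℂ (C.blockVec a) (C.blockVec b) / (overlapScale C.M C.first C.last C.leftBond : ℂ) -
      (if a = b then ((1 : ℝ) : ℂ) else 0) =
      (x : ℂ) * (bargmann (blockPoly C.M C.first C.last C.leftBond C.rightBond a.1 a.2)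
        (blockPoly C.M C.first C.last C.leftBond C.rightBond b.1 b.2) /
        overlapScale C.M C.first C.last C.leftBond -
        if a = b then (((a.1 : ℕ).factorial * (C.leftBond - a.1).factorial *
          ((a.2 : ℕ).factorial * (C.rightBond - a.2).factorial) : ℕ) : ℂ) else 0) := by
    rw [C.inner_blockVec, ← hx, mul_sub, mul_div_assoc]
    congr 1
    split_ifs with hab'
    · subst hab'
      have hw : ((a.1 : ℕ).factorial * (C.leftBond - a.1).factorial *
          ((a.2 : ℕ).factorial * (C.rightBond - a.2).factorial)) =
          endWeight C.leftBond C.rightBond a := rfl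
      rw [hw, ← Complex.ofReal_natCast, ← Complex.ofReal_mul, hx]
      congr 1
      have hs := Real.mul_self_sqrt (show (0 : ℝ) ≤ endWeight C.leftBond C.rightBond a by positivity)
      have := (hpos a).ne'
      field_simp
      linarith
    · simp
  rw [e, norm_mul, Complex.norm_real, Real.norm_of_nonneg hx0]
  calc _ ≤ 1 * (K * decay C.M C.first C.last) :=
        mul_le_mul hx1 h (norm_nonneg _) zero_le_one
    _ ≤ _ := by
        rw [one_mul]
        exact mul_le_mul_of_nonneg_left (decay_le _ _ _) hK0

lemma ChainBlock.card_end (C : ChainBlock) {Sm Sp : ℕ} (h1 : C.leftBond = Sm)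
    (h2 : C.rightBond = Sp) :
    Fintype.card (Fin (C.leftBond + 1) × Fin (C.rightBond + 1)) = (Sm + 1) * (Sp + 1) := by
  rw [Fintype.card_prod, Fintype.card_fin, Fintype.card_fin, h1, h2]

/-- Along a sequence of blocks as in the large block limit, the normalized block states become
orthogonal. -/
lemma exists_almostOrthogonal_sequence (C : ℕ → ChainBlock) (Sm Sp : ℕ)
    (hSm : ∀ᶠ i in atTop, (C i).leftBond = Sm) (hSp : ∀ᶠ i in atTop, (C i).rightBond = Sp)
    (hM : Tendsto (fun i => ∑ j ∈ Finset.Ico (C i).first (C i).last, (1 : ℝ) / ((C i).M j : ℝ))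
      atTop atTop) :
    ∃ δ : ℕ → ℝ, Tendsto δ atTop (𝓝 0) ∧ (∀ i, 0 ≤ δ i) ∧ ∀ᶠ i in atTop,
      0 < ∑ a, ‖(C i).blockVec a‖ ^ 2 ∧
      AlmostOrthogonal (C i).blockVec (∑ a, ‖(C i).blockVec a‖ ^ 2)
        (1 / (((Sm : ℝ) + 1) * (Sp + 1))) (δ i) := by
  obtain ⟨K, hK0, hK⟩ := ChainBlock.exists_almostOrthogonal_blockVec Sm Sp
  set ε : ℕ → ℝ := fun i =>
    K * (1 + ∑ j ∈ Finset.Ico (C i).first (C i).last, (1 : ℝ) / (C i).M j)⁻¹ with hε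
  have hlim : Tendsto ε atTop (𝓝 0) := by
    have := (tendsto_inv_atTop_zero.comp (tendsto_atTop_add_const_left atTop 1 hM)).const_mul K
    rwa [mul_zero] at this
  refine ⟨fun i => 4 * ε i, by simpa using hlim.const_mul 4, fun i => ?_, ?_⟩
  · have : 0 ≤ ∑ j ∈ Finset.Ico (C i).first (C i).last, (1 : ℝ) / (C i).M j :=
      Finset.sum_nonneg fun _ _ => by positivity
    simp only [hε]
    positivity
  · filter_upwards [hSm, hSp, hlim.eventually_le_const (show (0 : ℝ) < 1 / 2 by norm_num)]
      with i h1 h2 h3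
    have h := (hK (C i) h1 h2).normalize (overlapScale_pos _ _ _ _) h3
    rw [(C i).card_end h1 h2] at h
    push_cast at h
    exact h

lemma ChainBlock.densityOp_eq (C : ChainBlock) :
    C.densityOp = Matrix.toEuclideanCLM (𝕜 := ℂ) (mixture C.blockVec) := by
  rw [densityOp, densityMatrix_eq]

end

end AKLT

open AKLT Filter Topology in
theorem mainTheorem3 (C : ℕ → AKLT.ChainBlock) (Sm Sp : ℕ)
    (hL : Filter.Tendsto (fun i => (C i).L) Filter.atTop Filter.atTop)
    (hSm : Filter.Tendsto (fun i => (C i).leftBond) Filter.atTop (nhds Sm))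
    (hSp : Filter.Tendsto (fun i => (C i).rightBond) Filter.atTop (nhds Sp))
    (hM : Filter.Tendsto
      (fun i => ∑ j ∈ Finset.Ico (C i).first (C i).last, (1 : ℝ) / ((C i).M j : ℝ))
      Filter.atTop Filter.atTop) :
    (∀ᶠ i in Filter.atTop,
      Module.finrank ℂ (C i).groundSpace = (Sm + 1) * (Sp + 1)) ∧
    (∀ ε : ℝ, 0 < ε → ∀ᶠ i in Filter.atTop,
      ∀ n ≤ min (C i).leftBond (C i).rightBond,
      ∀ θ ∈ Set.Icc (0 : ℝ) Real.pi, ∀ φ ∈ Set.Icc (0 : ℝ) (2 * Real.pi),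
        (C i).groundState n θ φ ≠ 0 ∧
        ‖(C i).densityOp ((C i).groundState n θ φ) -
            ((1 : ℂ) / (((Sm : ℂ) + 1) * ((Sp : ℂ) + 1))) • (C i).groundState n θ φ‖ ≤
          ε * ‖(C i).groundState n θ φ‖) ∧
    Filter.Tendsto
      (fun i => ‖(C i).densityOp -
        ((1 : ℂ) / (((Sm : ℂ) + 1) * ((Sp : ℂ) + 1))) • (C i).groundSpace.starProjection‖)
      Filter.atTop (nhds 0) ∧
    (∀ᶠ i in Filter.atTop, ∀ ψ ∈ (C i).groundSpaceᗮ, (C i).densityOp ψ = 0) ∧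
    Filter.Tendsto (fun i => AKLT.vonNeumannEntropy (C i).densityMatrix) Filter.atTop
      (nhds (Real.log (((Sm : ℝ) + 1) * ((Sp : ℝ) + 1)))) ∧
    (∀ α : ℝ, α ≠ 1 →
      Filter.Tendsto (fun i => AKLT.renyiEntropy α (C i).densityMatrix) Filter.atTop
        (nhds (Real.log (((Sm : ℝ) + 1) * ((Sp : ℝ) + 1))))) := by
  have hm : ∀ᶠ i in atTop, (C i).leftBond = Sm := by
    rw [nhds_discrete] at hSm
    exact tendsto_pure.mp hSm
  have hp : ∀ᶠ i in atTop, (C i).rightBond = Sp := by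
    rw [nhds_discrete] at hSp
    exact tendsto_pure.mp hSp
  obtain ⟨δ, hδlim, hδ0, hδ⟩ := exists_almostOrthogonal_sequence C Sm Sp hm hp hM
  set D : ℝ := ((Sm : ℝ) + 1) * (Sp + 1) with hD
  have hD0 : 0 < D := by positivity
  have hcD : 1 / D * D = 1 := by field_simp
  have hc : ((1 : ℂ) / (((Sm : ℂ) + 1) * ((Sp : ℂ) + 1))) = ((1 / D : ℝ) : ℂ) := by
    rw [hD]; push_cast; rfl
  have hc0 : 0 < 1 / D := by positivity
  have hcard : ∀ i, (C i).leftBond = Sm → (C i).rightBond = Sp →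
      (Fintype.card (Fin ((C i).leftBond + 1) × Fin ((C i).rightBond + 1)) : ℝ) = D := by
    intro i h1 h2
    rw [(C i).card_end h1 h2, hD]
    push_cast
    rfl
  have hsmall : ∀ᶠ i in atTop, δ i * D ≤ 1 / D / 2 := by
    have : Tendsto (fun i => δ i * D) atTop (𝓝 0) := by simpa using hδlim.mul_const D
    exact this.eventually_le_const (by positivity)
  have hsmall3 : ∀ᶠ i in atTop, 8 * D ^ 3 * δ i < 1 := by
    have : Tendsto (fun i => 8 * D ^ 3 * δ i) atTop (𝓝 0) := by
      simpa using hδlim.const_mul (8 * D ^ 3)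
    exact this.eventually_lt_const (by norm_num)
  have hrate : Tendsto (fun i => 2 * D * δ i) atTop (𝓝 0) := by
    simpa using hδlim.const_mul (2 * D)
  have hne : ∀ᶠ i in atTop, (C i).first ≠ (C i).last := by
    -- The length enters only here: two sites suffice for distinct block ends.
    filter_upwards [hL.eventually_ge_atTop 2] with i hi
    unfold ChainBlock.first ChainBlock.last
    omega
  have hli : ∀ᶠ i in atTop, LinearIndependent ℂ (C i).blockVec := by
    filter_upwards [hm, hp, hδ, hsmall] with i h1 h2 h3 h4
    exact h3.2.linearIndependent h3.1 hc0 (by rwa [hcard i h1 h2])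
  have htrace : ∀ f : ℝ → ℝ, f 0 = 0 → ContinuousAt f (1 / D) →
      Tendsto (fun i => (Matrix.trace (cfc f (C i).densityMatrix)).re) atTop
        (𝓝 (D * f (1 / D))) := by
    intro f hf0 hf
    rw [Metric.tendsto_nhds]
    intro ε hε
    obtain ⟨r, hr, hfr⟩ := Metric.continuousAt_iff.mp hf (ε / (2 * D)) (by positivity)
    filter_upwards [hm, hp, hδ, hsmall3, hrate.eventually_lt_const hr] with i h1 h2 h3 h4 h5
    have h := h3.2.abs_trace_cfc_sub_le h3.1 (by rw [hcard i h1 h2, hcD]) (hδ0 i)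
      (by rwa [hcard i h1 h2]) hf0 (ε := ε / (2 * D)) (fun x hx => by
        rw [hcard i h1 h2] at hx
        exact (hfr (lt_of_le_of_lt hx h5)).le)
    rw [hcard i h1 h2, ← ChainBlock.densityMatrix_eq] at h
    rw [Real.dist_eq]
    refine lt_of_le_of_lt h ?_
    field_simp
    linarith
  refine ⟨?_, ?_, ?_, ?_, ?_, ?_⟩
  · filter_upwards [hm, hp, hli] with i h1 h2 h3
    rw [(C i).groundSpace_eq, finrank_span_eq_card h3, (C i).card_end h1 h2]
  · intro ε hε
    filter_upwards [hm, hp, hδ, hsmall, hne, hli, hrate.eventually_le_const hε]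
      with i h1 h2 h3 h4 h5 h6 h7 n hn θ _ φ _
    refine ⟨(C i).groundState_ne_zero h5 h6 hn θ φ, ?_⟩
    have h := h3.2.norm_apply_sub_le h3.1 hc0 (hδ0 i) (by rwa [hcard i h1 h2])
      ((C i).groundState_mem hn θ φ)
    rw [hcard i h1 h2, ← ChainBlock.densityOp_eq] at h
    rw [hc]
    exact h.trans (mul_le_mul_of_nonneg_right h7 (norm_nonneg _))
  · refine squeeze_zero' (Eventually.of_forall fun _ => norm_nonneg _) ?_ hrate
    filter_upwards [hm, hp, hδ, hsmall] with i h1 h2 h3 h4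
    have h := h3.2.norm_sub_starProjection_le h3.1 hc0 (hδ0 i) (by rwa [hcard i h1 h2])
    rw [hcard i h1 h2, ← ChainBlock.densityOp_eq] at h
    rw [hc]
    simpa only [(C i).groundSpace_eq] using h
  · refine Eventually.of_forall fun i ψ hψ => ?_
    rw [(C i).groundSpace_eq] at hψ
    rw [(C i).densityOp_eq]
    exact mixture_apply_eq_zero hψ
  · have h := (htrace (fun x => x * Real.log x) (by simp)
      (Real.continuous_mul_log.continuousAt)).neg
    have e : -(D * (1 / D * Real.log (1 / D))) = Real.log D := by
      rw [one_div, Real.log_inv]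
      field_simp
    simp only [e] at h
    exact h
  · intro α hα
    -- For `α ≤ 0` this function jumps at 0, but the zero eigenvalues contribute exactly 0 and the
    -- others tend to `1 / D`, so continuity there is enough.
    have hcont : ContinuousAt (fun x : ℝ => if x = 0 then 0 else x ^ α) (1 / D) := by
      have h1 : ContinuousAt (fun x : ℝ => x ^ α) (1 / D) :=
        Real.continuousAt_rpow_const _ _ (Or.inl hc0.ne')
      refine h1.congr ?_
      filter_upwards [isOpen_ne.mem_nhds hc0.ne'] with x hx
      rw [if_neg hx]
    have h := htrace _ (by simp) hcont
    have e : D * (1 / D) ^ α = D ^ (1 - α) := by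
      rw [one_div, Real.inv_rpow hD0.le, Real.rpow_sub hD0, Real.rpow_one, div_eq_mul_inv]
    simp only [hc0.ne', if_false, e] at h
    have hpos : 0 < D ^ (1 - α) := Real.rpow_pos_of_pos hD0 _
    have h2 := (h.log hpos.ne').const_mul (1 / (1 - α))
    have h1α : 1 - α ≠ 0 := sub_ne_zero.mpr hα.symm
    rw [Real.log_rpow hD0, ← mul_assoc, one_div_mul_cancel h1α, one_mul] at h2
    exact h2
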